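/- Let $p$ be a prime, let $R=\widehat{\mathbb Z_p^{ur}}$ be the $p$-adic completion of $\mathbb Z_p[\zeta\,;\,\zeta^{p^\nu-1}=1,\ \nu\ge 1]$ (equivalently, the ring $W(\overline{\mathbb F}_p)$ of $p$-typical Witt vectors of an algebraic closure of $\mathbb F_p$), let $k=R/pR$, and let $\phi:R\to R$ be the lift of the $p$-power Frobenius of $k$. For a finite tuple of variables $x$ put $R\{x\}=R[x,x',x'',\dots]$, extend $\phi$ to the ring endomorphism of $R\{x\}$ with $\phi(x^{(r)})=(x^{(r)})^p+p\,x^{(r+1)}$ for $r\ge 0$, and put $\delta F=(\phi(F)-F^p)/p$. For an affine scheme $X=\mathrm{Spec}\,R[x]/(f)$ with $x,f$ finite tuples, let $$\mathcal O^n(X)=R[x,x',\dots,x^{(n)}]^{\wedge}/(f,\delta f,\dots,\delta^n f),$$ where ${}^\wedge$ denotes $p$-adic completion; for $a\in\mathcal O(X)=R[x]/(f)$ let $\delta^r a\in\mathcal O^r(X)$ be the class of $\delta^r g$, where $g\in R[x]$ represents $a$. Elements of $\mathcal O^r(X)$ are also viewed in $\mathcal O^n(X)$, $n\ge r$, through the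 natural maps. Write $\overline A=A/pA$. Let $m\ge 1$, let $W_m(R)$ be the ring of $p$-typical Witt vectors of length $m+1$ over $R$, viewed as an $R$-algebra through the ring homomorphism $R\to W(R)\to W_m(R)$, where $R \to W(R)$ sends $a$ to the Witt vector with ghost components $a,\phi(a),\phi^2(a),\dots$, and let $\Sigma_m=\mathrm{Spec}\,W_m(R)$. For $1\le i\le m$ let $v_i=(0,\dots,0,1,0,\dots,0)\in W_m(R)$, with $1$ preceded by $i$ zeros, let $\pi=1-\delta v_1\in\mathcal O^1(\Sigma_m)$, and let $\Omega_m=\{1,\dots,m\}$. Then, for every finite presentation $W_m(R)\cong R[x]/(f)$ used to form the rings $\mathcal O^n(\Sigma_m)$ and every choice of representatives of the $v_i$ in $R[x]$: 1) for every $n\ge 2$ the image of $\pi^p$ in $\overline{\mathcal O^n(\Sigma_m)}$ is idempotent; 2) there is an isomorphism of $k$-algebras $$\varinjlim_{n}\ \overline{\mathcal O^n(\Sigma_m)}_{\pi}\ \simeq\ \frac{k[x_i^{(r)}\,;\,i\in\Omega_m,\ r\ge 0]}{\big(x_ix_j,\ (x_i^{(r)})^p\ ;\ i,j\in\Omega_m,\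 r\ge 1\big)},\qquad x_i:=x_i^{(0)},$$ which sends the class of $\delta^r v_i$ to the class of $x_i^{(r)}$ for all $i\in\Omega_m$ and $r\ge 0$. Here the limit is over $n\ge 1$ and the subscript $\pi$ denotes the localization at the image of $\pi$. -/

import Mathlib

open MvPolynomial

noncomputable section

/-! ### The base ring and its Frobenius lift -/

/-- The ring `R`, the `p`-adic completion of the maximal unramified extension of the `p`-adic
integers: the complete discrete valuation ring with maximal ideal generated by `p` and residue
field an algebraic closure of the field with `p` elements, that is, the ring of `p`-typical Witt
vectors of that algebraic closure. -/
abbrev ZpUr (p : ℕ) [Fact p.Prime] : Type := WittVector p (AlgebraicClosure (ZMod p))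

/-- The residue field `k = R / pR`. -/
abbrev ResField (p : ℕ) [Fact p.Prime] : Type := ZpUr p ⧸ Ideal.span {(p : ZpUr p)}

/-- The lift of Frobenius on `R`. -/
def frobR (p : ℕ) [Fact p.Prime] : ZpUr p →+* ZpUr p := WittVector.frobenius

theorem frobR_dvd (p : ℕ) [Fact p.Prime] (a : ZpUr p) : (p : ZpUr p) ∣ frobR p a - a ^ p := by
  rw [← Ideal.mem_span_singleton, WittVector.mem_span_p_iff_coeff_zero_eq_zero]
  change WittVector.constantCoeff (frobR p a - a ^ p) = 0
  rw [map_sub, map_pow, sub_eq_zero]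
  exact WittVector.coeff_frobenius_charP p a 0

theorem ZpUr.p_ne_zero (p : ℕ) [Fact p.Prime] : (p : ZpUr p) ≠ 0 :=
  (WittVector.irreducible p).ne_zero

/-! ### The `R`-algebra of Witt vectors of length `m + 1` over `R` -/

/-- A Witt vector over `R` is determined by its ghost components. -/
theorem ZpUr.ghost_ext (p : ℕ) [Fact p.Prime] {x y : WittVector p (ZpUr p)}
    (h : ∀ n, WittVector.ghostComponent n x = WittVector.ghostComponent n y) : x = y := by
  refine WittVector.ext fun n => ?_
  induction n using Nat.strong_induction_on with
  | _ n ih =>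
    have hn := h n
    simp only [WittVector.ghostComponent_apply, aeval_wittPolynomial] at hn
    rw [Finset.sum_range_succ, Finset.sum_range_succ,
      Finset.sum_congr rfl (fun i hi => by rw [ih i (Finset.mem_range.1 hi)])] at hn
    have h2 := add_left_cancel hn
    simp only [Nat.sub_self, pow_zero, pow_one] at h2
    exact mul_left_cancel₀ (pow_ne_zero _ (ZpUr.p_ne_zero p)) h2

open Classical in
/-- The coefficients of the Witt vector with ghost components `a, φ a, φ² a, …`. -/
def deltaCoeff (p : ℕ) [Fact p.Prime] (a : ZpUr p) : ℕ → ZpUr p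
  | n =>
    if h : (p : ZpUr p) ^ n ∣ (frobR p)^[n] a -
        ∑ i : Fin n, (p : ZpUr p) ^ (i : ℕ) * deltaCoeff p a i ^ p ^ (n - (i : ℕ))
    then h.choose else 0
termination_by n => n
decreasing_by exact i.2

theorem deltaCoeff_sum (p : ℕ) [Fact p.Prime] (a : ZpUr p) (n : ℕ) :
    ∑ i ∈ Finset.range (n + 1), (p : ZpUr p) ^ i * deltaCoeff p a i ^ p ^ (n - i)
      = (frobR p)^[n] a := by
  induction n with
  | zero =>
    have h : (p : ZpUr p) ^ 0 ∣ (frobR p)^[0] a -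
        ∑ i : Fin 0, (p : ZpUr p) ^ (i : ℕ) * deltaCoeff p a i ^ p ^ (0 - (i : ℕ)) := by simp
    have hs := h.choose_spec
    have e : deltaCoeff p a 0 = h.choose := by rw [deltaCoeff, dif_pos h]
    rw [← e] at hs
    simpa using hs.symm
  | succ n ih =>
    have h : (p : ZpUr p) ^ (n + 1) ∣ (frobR p)^[n + 1] a -
        ∑ i : Fin (n + 1), (p : ZpUr p) ^ (i : ℕ) *
          deltaCoeff p a i ^ p ^ (n + 1 - (i : ℕ)) := by
      rw [Function.iterate_succ_apply', ← ih, map_sum,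
        Fin.sum_univ_eq_sum_range
          (fun i => (p : ZpUr p) ^ i * deltaCoeff p a i ^ p ^ (n + 1 - i)) (n + 1),
        ← Finset.sum_sub_distrib]
      refine Finset.dvd_sum fun i hi => ?_
      have hi' : i ≤ n := Nat.lt_succ_iff.1 (Finset.mem_range.1 hi)
      rw [map_mul, map_pow, map_pow, map_natCast, ← mul_sub,
        show n + 1 = i + (n - i + 1) by omega, pow_add (p : ZpUr p) i,
        show i + (n - i + 1) - i = (n - i) + 1 by omega]
      refine mul_dvd_mul_left _ ?_
      rw [pow_succ' p (n - i), pow_mul]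
      exact dvd_sub_pow_of_dvd_sub (frobR_dvd p _) (n - i)
    have hs := h.choose_spec
    have e : deltaCoeff p a (n + 1) = h.choose := by rw [deltaCoeff, dif_pos h]
    rw [← e, Fin.sum_univ_eq_sum_range
          (fun i => (p : ZpUr p) ^ i * deltaCoeff p a i ^ p ^ (n + 1 - i)) (n + 1)] at hs
    rw [Finset.sum_range_succ, Nat.sub_self, pow_zero, pow_one, ← hs]
    ring

theorem ghostComponent_deltaCoeff (p : ℕ) [Fact p.Prime] (a : ZpUr p) (n : ℕ) :
    WittVector.ghostComponent n (WittVector.mk p (deltaCoeff p a)) = (frobR p)^[n] a := by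
  rw [WittVector.ghostComponent_apply, aeval_wittPolynomial]
  exact deltaCoeff_sum p a n

/-- The canonical ring homomorphism `R → W(R)`: it sends `a` to the unique Witt vector whose ghost
components are `a, φ a, φ² a, …`. -/
def toWitt (p : ℕ) [Fact p.Prime] : ZpUr p →+* WittVector p (ZpUr p) where
  toFun a := WittVector.mk p (deltaCoeff p a)
  map_one' := ZpUr.ghost_ext p fun n => by
    rw [ghostComponent_deltaCoeff, map_one, iterate_map_one]
  map_zero' := ZpUr.ghost_ext p fun n => by
    rw [ghostComponent_deltaCoeff, map_zero, iterate_map_zero]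
  map_mul' a b := ZpUr.ghost_ext p fun n => by
    rw [map_mul, ghostComponent_deltaCoeff, ghostComponent_deltaCoeff, ghostComponent_deltaCoeff,
      iterate_map_mul]
  map_add' a b := ZpUr.ghost_ext p fun n => by
    rw [map_add, ghostComponent_deltaCoeff, ghostComponent_deltaCoeff, ghostComponent_deltaCoeff,
      iterate_map_add]

/-- `W_m(R)`: the `p`-typical Witt vectors of length `m + 1` over `R`. -/
abbrev WittRing (p : ℕ) [Fact p.Prime] (m : ℕ) : Type := TruncatedWittVector p (m + 1) (ZpUr p)

/-- `W_m(R)` is an `R`-algebra through `R → W(R) → W_m(R)`. -/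
instance WittRing.algebra (p : ℕ) [Fact p.Prime] (m : ℕ) : Algebra (ZpUr p) (WittRing p m) :=
  ((WittVector.truncate (m + 1)).comp (toWitt p)).toAlgebra

/-- `v_i = (0, …, 0, 1, 0, …, 0)` in `W_m(R)`, with `1` preceded by `i` zeros. -/
def wittV (p : ℕ) [Fact p.Prime] (m i : ℕ) : WittRing p m :=
  TruncatedWittVector.mk p fun j => if (j : ℕ) = i then 1 else 0

/-! ### The `p`-derivation on `R{x}` -/

section Jets

variable (p : ℕ) [Fact p.Prime] {ι : Type*}

/-- `R{x} = R[x, x', x'', …]` for a tuple `x` indexed by `ι`; the variable with index `(i, r)` is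
the `i`-th entry of the `r`-th tuple. -/
abbrev DiffPoly (ι : Type*) : Type _ := MvPolynomial (ι × ℕ) (ZpUr p)

/-- The ring endomorphism `φ` of `R{x}` which extends `φ` on `R` and sends `x` to `x ^ p + p x'`,
`x'` to `x' ^ p + p x''`, and so on. -/
def jetPhi : DiffPoly p ι →+* DiffPoly p ι :=
  eval₂Hom (C.comp (frobR p)) fun j => X j ^ p + (p : DiffPoly p ι) * X (j.1, j.2 + 1)

theorem jetPhi_dvd (F : DiffPoly p ι) : (p : DiffPoly p ι) ∣ jetPhi p F - F ^ p := by
  have hp : p.Prime := Fact.out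
  induction F using MvPolynomial.induction_on with
  | C a =>
    obtain ⟨b, hb⟩ := frobR_dvd p a
    refine ⟨C b, ?_⟩
    have := congrArg (C (σ := ι × ℕ)) hb
    simpa [jetPhi] using this
  | add F G hF hG =>
    obtain ⟨r, hr⟩ := exists_add_pow_prime_eq hp F G
    rw [hr, map_add]
    have := dvd_sub (dvd_add hF hG) (Dvd.intro (F * G * r) rfl : (p : DiffPoly p ι) ∣ _)
    convert this using 1
    ring
  | mul_X F j hF =>
    rw [map_mul, mul_pow]
    have hX : (p : DiffPoly p ι) ∣ jetPhi p (X j) - X j ^ p := by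
      simp [jetPhi]
    have := dvd_add (hF.mul_right (jetPhi p (X j))) (hX.mul_left (F ^ p))
    convert this using 1
    ring

/-- The `p`-derivation `δ F = (φ F - F ^ p) / p` on `R{x}`. -/
def jetDelta (F : DiffPoly p ι) : DiffPoly p ι := (jetPhi_dvd p F).choose

theorem jetDelta_spec (F : DiffPoly p ι) :
    (p : DiffPoly p ι) * jetDelta p F = jetPhi p F - F ^ p :=
  (jetPhi_dvd p F).choose_spec.symm

variable (ι) in
/-- `R[x, x', …, x^(n)]` as a subalgebra of `R{x}`. -/
def jetPoly (n : ℕ) : Subalgebra (ZpUr p) (DiffPoly p ι) :=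
  supported (ZpUr p) {j : ι × ℕ | j.2 ≤ n}

theorem jetPoly_mono {n n' : ℕ} (h : n ≤ n') : jetPoly p ι n ≤ jetPoly p ι n' :=
  supported_mono fun _ hj => le_trans (show _ ≤ n from hj) h

theorem jetPhi_mem {n : ℕ} {F : DiffPoly p ι} (hF : F ∈ jetPoly p ι n) :
    jetPhi p F ∈ jetPoly p ι (n + 1) := by
  induction hF using Algebra.adjoin_induction with
  | mem x hx =>
    obtain ⟨j, hj, rfl⟩ := hx
    have hj' : j.2 ≤ n := hj
    have h1 : (X j : DiffPoly p ι) ∈ jetPoly p ι (n + 1) :=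
      Algebra.subset_adjoin ⟨j, show j.2 ≤ n + 1 by omega, rfl⟩
    have h2 : (X (j.1, j.2 + 1) : DiffPoly p ι) ∈ jetPoly p ι (n + 1) :=
      Algebra.subset_adjoin ⟨(j.1, j.2 + 1), show j.2 + 1 ≤ n + 1 by omega, rfl⟩
    simpa [jetPhi] using add_mem (pow_mem h1 p) (mul_mem (natCast_mem _ p) h2)
  | algebraMap r =>
    have : jetPhi p (algebraMap (ZpUr p) (DiffPoly p ι) r)
        = algebraMap (ZpUr p) (DiffPoly p ι) (frobR p r) := by
      simp [jetPhi, algebraMap_eq]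
    rw [this]
    exact Subalgebra.algebraMap_mem _ _
  | add x y _ _ hx hy => rw [map_add]; exact add_mem hx hy
  | mul x y _ _ hx hy => rw [map_mul]; exact mul_mem hx hy

theorem jetDelta_mem {n : ℕ} {F : DiffPoly p ι} (hF : F ∈ jetPoly p ι n) :
    jetDelta p F ∈ jetPoly p ι (n + 1) := by
  have h : (p : DiffPoly p ι) * jetDelta p F ∈ jetPoly p ι (n + 1) := by
    rw [jetDelta_spec]
    exact sub_mem (jetPhi_mem p hF) (pow_mem (jetPoly_mono p (Nat.le_succ n) hF) p)
  have e : (p : DiffPoly p ι) = C (p : ZpUr p) := by simp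
  rw [e] at h
  unfold jetPoly at h ⊢
  rw [mem_supported] at h ⊢
  rwa [vars_C_mul _ (ZpUr.p_ne_zero p)] at h

/-- The inclusion of `R[x]` in `R{x}`. -/
def toDiffPoly : MvPolynomial ι (ZpUr p) →ₐ[ZpUr p] DiffPoly p ι :=
  rename fun i => (i, 0)

theorem jetDelta_iterate_mem (g : MvPolynomial ι (ZpUr p)) {r n : ℕ} (h : r ≤ n) :
    (jetDelta p)^[r] (toDiffPoly p g) ∈ jetPoly p ι n := by
  refine jetPoly_mono p h ?_
  clear h
  induction r with
  | zero =>
    refine mem_supported.2 fun j hj => ?_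
    classical
    obtain ⟨i, -, rfl⟩ := Finset.mem_image.1 (vars_rename (fun i : ι => (i, 0)) g hj)
    exact le_refl 0
  | succ r ih =>
    rw [Function.iterate_succ_apply']
    exact jetDelta_mem p ih

/-- `δ^r g` as an element of `R[x, x', …, x^(n)]`, for `g` in `R[x]` and `r ≤ n`. -/
def jetDeltaIter (g : MvPolynomial ι (ZpUr p)) {r n : ℕ} (h : r ≤ n) : jetPoly p ι n :=
  ⟨(jetDelta p)^[r] (toDiffPoly p g), jetDelta_iterate_mem p g h⟩

/-! ### `p`-adic completion -/

/-- The `p`-adic completion of a ring. -/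
abbrev PCompletion (A : Type*) [CommRing A] : Type _ := AdicCompletion (Ideal.span {(p : A)}) A

/-- The canonical map from a ring to its `p`-adic completion. -/
def toPCompletion (A : Type*) [CommRing A] : A →+* PCompletion p A :=
  algebraMap A (PCompletion p A)

variable {A B : Type*} [CommRing A] [CommRing B]

theorem span_p_pow_le (p : ℕ) (f : A →+* B) (n : ℕ) :
    Ideal.span {(p : A)} ^ n ≤ (Ideal.span {(p : B)} ^ n).comap f := by
  rw [Ideal.span_singleton_pow, Ideal.span_singleton_pow, Ideal.span_singleton_le_iff_mem,
    Ideal.mem_comap, map_pow, map_natCast]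
  exact Ideal.mem_span_singleton_self _

/-- The ring homomorphisms from `p`-adic completions to truncations induced by a ring
homomorphism. -/
def pCompletionMapAux (f : A →+* B) (n : ℕ) : PCompletion p A →+* B ⧸ Ideal.span {(p : B)} ^ n :=
  (Ideal.quotientMap _ f (span_p_pow_le p f n)).comp
    (AdicCompletion.evalₐ (Ideal.span {(p : A)}) n).toRingHom

theorem pCompletionMapAux_compat (p : ℕ) [Fact p.Prime] (f : A →+* B) {a b : ℕ} (hab : a ≤ b) :
    (Ideal.Quotient.factorPow (Ideal.span {(p : B)}) hab).comp (pCompletionMapAux p f b) =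
      pCompletionMapAux p f a := by
  ext x
  obtain ⟨x, rfl⟩ := AdicCompletion.mk_surjective _ _ x
  simp only [pCompletionMapAux, RingHom.comp_apply, AlgHom.toRingHom_eq_coe, RingHom.coe_coe,
    AdicCompletion.evalₐ_mk, Ideal.quotientMap_mk]
  refine (Ideal.Quotient.eq (I := Ideal.span {(p : B)} ^ a)).2 ?_
  rw [← map_sub]
  refine span_p_pow_le p f a ?_
  rw [← Ideal.Quotient.eq]
  exact AdicCompletion.Ideal.mk_eq_mk _ hab x

/-- The ring homomorphism between `p`-adic completions induced by a ring homomorphism. -/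
def pCompletionMap (f : A →+* B) : PCompletion p A →+* PCompletion p B :=
  AdicCompletion.liftRingHom (Ideal.span {(p : B)}) (pCompletionMapAux p f)
    fun hab => pCompletionMapAux_compat p f hab

theorem pCompletionMap_of (f : A →+* B) (a : A) :
    pCompletionMap p f (toPCompletion p A a) = toPCompletion p B (f a) := by
  refine AdicCompletion.ext_evalₐ fun n => ?_
  unfold pCompletionMap
  rw [AdicCompletion.evalₐ_liftRingHom]
  rfl

end Jets

/-! ### The rings of functions on the `p`-jet spaces -/

section JetRing

variable {p : ℕ} [Fact p.Prime] {ι κ : Type*} {S : Type*} [CommRing S] [Algebra (ZpUr p) S]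
  (P : Algebra.Presentation (ZpUr p) S ι κ)

/-- The ideal `(f, δ f, …, δ^n f)` of the `p`-adic completion of `R[x, x', …, x^(n)]`, where `f`
is the tuple of relations of the presentation `S = R[x] / (f)`. -/
def jetIdeal (n : ℕ) : Ideal (PCompletion p (jetPoly p ι n)) :=
  Ideal.span {y | ∃ (r : ℕ) (h : r ≤ n) (s : κ),
    y = toPCompletion p _ (jetDeltaIter p (P.relation s) h)}

/-- `O^n(X)` for `X = Spec S`, `S = R[x] / (f)`: the quotient of the `p`-adic completion of
`R[x, x', …, x^(n)]` by `(f, δ f, …, δ^n f)`. -/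
abbrev JetRing (n : ℕ) : Type _ := PCompletion p (jetPoly p ι n) ⧸ jetIdeal P n

/-- The class in `O^n(X)` of an element of `R[x, x', …, x^(n)]`. -/
def jetMk (n : ℕ) : jetPoly p ι n →+* JetRing P n :=
  (Ideal.Quotient.mk (jetIdeal P n)).comp (toPCompletion p _)

/-- The structure map from `R` to `O^n(X)`. -/
def jetConst (n : ℕ) : ZpUr p →+* JetRing P n := (jetMk P n).comp (algebraMap _ _)

/-- `δ^r a` in `O^r(X)` for `a` in `S`: the class of `δ^r g`, where `g` in `R[x]` is a
representative of `a`, namely the one provided by the presentation (a presentation comes with an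
arbitrary choice of representatives). -/
def jetDeltaClass (r : ℕ) (a : S) : JetRing P r :=
  jetMk P r (jetDeltaIter p (P.σ a) (le_refl r))

/-- The inclusion of `R[x, …, x^(n)]` in `R[x, …, x^(n')]` for `n ≤ n'`. -/
def jetPolyIncl {n n' : ℕ} (h : n ≤ n') : jetPoly p ι n →+* jetPoly p ι n' :=
  (Subalgebra.inclusion (jetPoly_mono p h)).toRingHom

theorem jetIdeal_le {n n' : ℕ} (h : n ≤ n') :
    jetIdeal P n ≤ (jetIdeal P n').comap (pCompletionMap p (jetPolyIncl h)) := by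
  refine Ideal.span_le.2 ?_
  rintro _ ⟨r, hr, s, rfl⟩
  rw [SetLike.mem_coe, Ideal.mem_comap, pCompletionMap_of]
  exact Ideal.subset_span ⟨r, hr.trans h, s, rfl⟩

/-- The natural map from `O^n(X)` to `O^{n'}(X)` for `n ≤ n'`. -/
def jetTransition {n n' : ℕ} (h : n ≤ n') : JetRing P n →+* JetRing P n' :=
  Ideal.quotientMap (jetIdeal P n') (pCompletionMap p (jetPolyIncl h)) (jetIdeal_le P h)

theorem jetTransition_jetMk {n n' : ℕ} (h : n ≤ n') (a : jetPoly p ι n) :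
    jetTransition P h (jetMk P n a) = jetMk P n' (jetPolyIncl h a) := by
  unfold jetTransition jetMk
  rw [RingHom.comp_apply, Ideal.quotientMap_mk, pCompletionMap_of]
  rfl

/-- The reduction of `O^n(X)` modulo `p`. -/
abbrev JetRingBar (n : ℕ) : Type _ := JetRing P n ⧸ Ideal.span {(p : JetRing P n)}

/-- The image in the reduction of `O^{n'}(X)` modulo `p` of an element of `O^n(X)`, `n ≤ n'`. -/
def jetBar {n n' : ℕ} (h : n ≤ n') : JetRing P n →+* JetRingBar P n' :=
  (Ideal.Quotient.mk _).comp (jetTransition P h)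

/-- The natural map between reductions modulo `p`. -/
def jetTransitionBar {n n' : ℕ} (h : n ≤ n') : JetRingBar P n →+* JetRingBar P n' :=
  Ideal.quotientMap _ (jetTransition P h) (by
    rw [Ideal.span_singleton_le_iff_mem, Ideal.mem_comap, map_natCast]
    exact Ideal.mem_span_singleton_self _)

end JetRing

/-! ### The limit of the `p`-jets of `W_m(R)` -/

section Witt

variable {p : ℕ} [Fact p.Prime] {m : ℕ} {ι κ : Type*}
  (P : Algebra.Presentation (ZpUr p) (WittRing p m) ι κ)

/-- The element `π = 1 - δ v_1` of `O^1(Spec W_m(R))`. -/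
def jetPi : JetRing P 1 := 1 - jetDeltaClass P 1 (wittV p m 1)

theorem jetTransitionBar_jetPi {n n' : ℕ} (h : 1 ≤ n) (h' : n ≤ n') :
    jetTransitionBar P h' (jetBar P h (jetPi P)) = jetBar P (h.trans h') (jetPi P) := by
  unfold jetTransitionBar jetBar jetPi jetDeltaClass
  simp only [RingHom.comp_apply, map_sub, map_one, jetTransition_jetMk, Ideal.quotientMap_mk]
  rfl

/-- The localization of the reduction modulo `p` of `O^{n+1}(Spec W_m(R))` at `π`
(the shift in the index is there because `π` lives in order at least `1`). -/
abbrev JetLoc (n : ℕ) : Type _ :=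
  Localization.Away (jetBar P (Nat.succ_le_succ (Nat.zero_le n)) (jetPi P))

/-- The transition maps between the localizations. -/
def jetLocMap (n n' : ℕ) (h : n ≤ n') : JetLoc P n →+* JetLoc P n' :=
  IsLocalization.map (JetLoc P n') (jetTransitionBar P (Nat.succ_le_succ h))
    (M := Submonoid.powers (jetBar P (Nat.succ_le_succ (Nat.zero_le n)) (jetPi P)))
    (T := Submonoid.powers (jetBar P (Nat.succ_le_succ (Nat.zero_le n')) (jetPi P)))
    (by
      rw [Submonoid.powers_le, Submonoid.mem_comap, jetTransitionBar_jetPi]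
      exact Submonoid.mem_powers _)

/-- The direct limit over `n` of the localizations at `π` of the reductions modulo `p` of
`O^n(Spec W_m(R))`. -/
abbrev JetLim : Type _ := Ring.DirectLimit (JetLoc P) fun n n' h => jetLocMap P n n' h

/-- The image in the direct limit of an element of `O^r(Spec W_m(R))`, taken through order
`n + 1`, where `r ≤ n + 1`. -/
def toJetLim {r n : ℕ} (h : r ≤ n + 1) : JetRing P r →+* JetLim P :=
  ((Ring.DirectLimit.of (JetLoc P) (fun n n' h => jetLocMap P n n' h) n).comp
    (algebraMap (JetRingBar P (n + 1)) (JetLoc P n))).comp (jetBar P h)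

end Witt

/-- The ideal of `k[x_i^(r) ; 1 ≤ i ≤ m, r ≥ 0]` generated by all `x_i x_j`, where
`x_i = x_i^(0)`, and all `(x_i^(r)) ^ p` with `r ≥ 1`. -/
def limitIdeal (p : ℕ) [Fact p.Prime] (m : ℕ) :
    Ideal (MvPolynomial (Set.Icc 1 m × ℕ) (ResField p)) :=
  Ideal.span ({f | ∃ i j : Set.Icc 1 m, f = X (i, 0) * X (j, 0)} ∪
    {f | ∃ (i : Set.Icc 1 m) (r : ℕ), 1 ≤ r ∧ f = X (i, r) ^ p})

/-- The ring `k[x_i^(r) ; 1 ≤ i ≤ m, r ≥ 0] / (x_i x_j, (x_i^(r)) ^ p for r ≥ 1)`. -/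
abbrev LimitRing (p : ℕ) [Fact p.Prime] (m : ℕ) : Type :=
  MvPolynomial (Set.Icc 1 m × ℕ) (ResField p) ⧸ limitIdeal p m

end

/-! ### The calculus of `δ` and `φ` on differential polynomials -/

section DeltaCalculus

variable (p : ℕ) [hp : Fact p.Prime] {ι : Type*}

/-! The algebra `W_m(R)` is free over `R` on `1, v_1, …, v_m`, with relations `v_i v_j = p^i v_j`
for `i ≤ j`. Modulo `p` these give `v_i v_j = 0`; the real content concerns the higher `δ^r v_i`.

Let `w = v_j`. Applying `δ` to `v_1 w = p w` gives a relation of the form `p y = 0`, where, up to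
terms in `v_1` and `w`, `y` is `δw (δv_1 - 1)` (`natCast_mul_torsionElt`). One cannot divide by `p`,
but in a ring with a `p`-derivation `φ` kills `p`-torsion: if `p F = 0`, then `0 = δ(p F) = φ(F) -
p^(p-1) F^p`, and the last term vanishes (`jetPhi_mem_of_natCast_mul_mem`). Hence `y^p = 0` modulo
`p`. For `w = v_1` and `d = δv_1` this reads `(d^2 - d)^p = 0`, so `d^p` and `π^p = 1 - d^p` are
idempotent. Once `π` is inverted, applying `δ^s` to `φ(y) = 0` gives `(δ^(s+1) w)^p = 0` by
induction on `s` (`map_jetDelta_iterate_pow_eq_zero`).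

There are no further relations: the ideal generated by all `p x_i^(r)`, all `(x_i^(r))^p` and all
`x_i x_j` is stable under `δ` and contains the relations of `W_m(R)`
(`jetDelta_mem_limitDeltaIdeal`), so the limit ring satisfies all `δ^r` of these relations. There
`π` is a unit because `δv_1` is nilpotent.

The rest is formal. Modulo `p` the completions disappear, and the limit is universal among rings
with `p = 0` that receive a map from `R{x}` killing all `δ^r f` and inverting `π`
(`jetLim_ringHom_ext`, `exists_jetLim_lift`). Maps of polynomial algebras prolong to maps commuting
with `δ`, which compares an arbitrary presentation with the one by the `v_i`
(`exists_equiv_limitRing`). -/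

theorem DiffPoly.p_ne_zero : (p : DiffPoly p ι) ≠ 0 := by
  have e : (p : DiffPoly p ι) = C (p : ZpUr p) := by simp
  rw [e, Ne, C_eq_zero]
  exact ZpUr.p_ne_zero p

theorem natCast_p_pow_pred {A : Type*} [CommRing A] : (p : A) ^ (p - 1) = p * (p : A) ^ (p - 2) := by
  have := hp.out.two_le
  rw [← pow_succ', show p - 2 + 1 = p - 1 by omega]

theorem jetDelta_eq_of_mul_eq {F G : DiffPoly p ι} (h : (p : DiffPoly p ι) * G = jetPhi p F - F ^ p) :
    jetDelta p F = G :=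
  mul_left_cancel₀ (DiffPoly.p_ne_zero p) ((jetDelta_spec p F).trans h.symm)

theorem jetPhi_eq (F : DiffPoly p ι) : jetPhi p F = F ^ p + (p : DiffPoly p ι) * jetDelta p F := by
  rw [jetDelta_spec]; ring

theorem jetPhi_X (j : ι × ℕ) : jetPhi p (X j : DiffPoly p ι) =
    X j ^ p + (p : DiffPoly p ι) * X (j.1, j.2 + 1) := by
  simp [jetPhi]

theorem jetPhi_C (c : ZpUr p) : jetPhi p (C c : DiffPoly p ι) = C (frobR p c) := by
  simp [jetPhi]

theorem jetDelta_X (i : ι) (r : ℕ) : jetDelta p (X (i, r) : DiffPoly p ι) = X (i, r + 1) :=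
  jetDelta_eq_of_mul_eq p (by rw [jetPhi_X]; ring)

theorem jetDelta_iterate_X (i : ι) (r s : ℕ) :
    (jetDelta p)^[s] (X (i, r) : DiffPoly p ι) = X (i, r + s) := by
  induction s with
  | zero => rfl
  | succ s ih => rw [Function.iterate_succ_apply', ih, jetDelta_X]; rfl

theorem jetDelta_zero : jetDelta p (0 : DiffPoly p ι) = 0 :=
  jetDelta_eq_of_mul_eq p (by simp [hp.out.ne_zero])

theorem jetDelta_mul (F G : DiffPoly p ι) :
    jetDelta p (F * G) = jetDelta p F * jetPhi p G + F ^ p * jetDelta p G :=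
  jetDelta_eq_of_mul_eq p (by
    rw [mul_add, ← mul_assoc, mul_left_comm _ (F ^ p), jetDelta_spec, jetDelta_spec, map_mul]; ring)

theorem jetDelta_natCast_mul (F : DiffPoly p ι) :
    jetDelta p ((p : DiffPoly p ι) * F) = jetPhi p F - (p : DiffPoly p ι) ^ (p - 1) * F ^ p :=
  jetDelta_eq_of_mul_eq p (by
    rw [map_mul, map_natCast, mul_pow, mul_sub, ← mul_assoc, ← pow_succ',
      Nat.sub_add_cancel hp.out.one_le])

/-- The correction `((F + G)^p - F^p - G^p) / p` is a multiple of `F G` by a polynomial in `F` and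
`G`, hence of no higher order. -/
theorem jetDelta_add_of_mem {n : ℕ} {F G : DiffPoly p ι} (hF : F ∈ jetPoly p ι n)
    (hG : G ∈ jetPoly p ι n) :
    ∃ r ∈ jetPoly p ι n, jetDelta p (F + G) = jetDelta p F + jetDelta p G - r * F * G := by
  obtain ⟨r, hr⟩ := exists_add_pow_prime_eq hp.out (⟨F, hF⟩ : jetPoly p ι n) ⟨G, hG⟩
  refine ⟨r, r.2, jetDelta_eq_of_mul_eq p ?_⟩
  have hr' := congrArg Subtype.val hr
  push_cast at hr'
  rw [map_add, hr', mul_sub, mul_add, jetDelta_spec, jetDelta_spec]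
  ring

theorem jetDelta_add (F G : DiffPoly p ι) :
    ∃ r, jetDelta p (F + G) = jetDelta p F + jetDelta p G - r * F * G := by
  obtain ⟨r, hr⟩ := exists_add_pow_prime_eq hp.out F G
  refine ⟨r, jetDelta_eq_of_mul_eq p ?_⟩
  rw [map_add, hr, mul_sub, mul_add, jetDelta_spec, jetDelta_spec]
  ring

theorem jetPhi_jetDelta (F : DiffPoly p ι) : jetDelta p (jetPhi p F) = jetPhi p (jetDelta p F) :=
  jetDelta_eq_of_mul_eq p (by
    rw [← map_natCast (jetPhi p) p, ← map_mul, jetDelta_spec, map_sub, map_pow])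

theorem jetPhi_jetDelta_iterate (F : DiffPoly p ι) (s : ℕ) :
    (jetDelta p)^[s] (jetPhi p F) = jetPhi p ((jetDelta p)^[s] F) :=
  (Function.Commute.iterate_left (fun F => jetPhi_jetDelta p F) s) F

variable {p} in
-- Although `δ` is not additive, the defects in its sum and product rules are multiples of elements
-- already in the ideal, so generators suffice.
theorem jetDelta_mem_of_span {G : Set (DiffPoly p ι)} {J : Ideal (DiffPoly p ι)}
    (hle : Ideal.span G ≤ J) (hδ : ∀ g ∈ G, jetDelta p g ∈ J) {F : DiffPoly p ι}
    (hF : F ∈ Ideal.span G) : jetDelta p F ∈ J := by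
  induction hF using Submodule.span_induction with
  | mem g hg => exact hδ g hg
  | zero => rw [jetDelta_zero]; exact J.zero_mem
  | add F F' hF _ ih ih' =>
    obtain ⟨r, hr⟩ := jetDelta_add p F F'
    rw [hr]
    exact J.sub_mem (J.add_mem ih ih') (J.mul_mem_right _ (J.mul_mem_left _ (hle hF)))
  | smul a F hF ih =>
    rw [smul_eq_mul, mul_comm, jetDelta_mul]
    exact J.add_mem (J.mul_mem_right _ ih)
      (J.mul_mem_right _ (J.pow_mem_of_mem (hle hF) _ hp.out.pos))

variable {p} in
theorem jetDelta_sub_mem {J : Ideal (DiffPoly p ι)} (hJ : ∀ F ∈ J, jetDelta p F ∈ J)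
    {F G : DiffPoly p ι} (h : F - G ∈ J) : jetDelta p F - jetDelta p G ∈ J := by
  obtain ⟨r, hr⟩ := jetDelta_add p (F - G) G
  rw [sub_add_cancel] at hr
  rw [hr]
  have := J.sub_mem (hJ _ h) (J.mul_mem_right G (J.mul_mem_left r h))
  convert this using 1
  ring

variable {p} in
theorem jetDelta_iterate_sub_mem {J : Ideal (DiffPoly p ι)} (hJ : ∀ F ∈ J, jetDelta p F ∈ J)
    {F G : DiffPoly p ι} (h : F - G ∈ J) (s : ℕ) :
    (jetDelta p)^[s] F - (jetDelta p)^[s] G ∈ J := by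
  induction s with
  | zero => exact h
  | succ s ih =>
    rw [Function.iterate_succ_apply', Function.iterate_succ_apply']
    exact jetDelta_sub_mem hJ ih

variable {p} in
theorem jetDelta_iterate_ideal_mem {J : Ideal (DiffPoly p ι)} (hJ : ∀ F ∈ J, jetDelta p F ∈ J)
    {F : DiffPoly p ι} (h : F ∈ J) (s : ℕ) : (jetDelta p)^[s] F ∈ J := by
  induction s with
  | zero => exact h
  | succ s ih => rw [Function.iterate_succ_apply']; exact hJ _ ih

variable {p} in
-- A version with control of orders: membership in an ideal of `R{x}` says nothing about the order
-- of the coefficients, so spans are taken over `R[x, …, x^(n)]`, and `δ` costs one order.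
theorem jetDelta_mem_of_span_jetPoly {n : ℕ} {G G' : Set (DiffPoly p ι)}
    (hG : ∀ g ∈ G, g ∈ jetPoly p ι n)
    (hle : ∀ g ∈ G, g ∈ Submodule.span (jetPoly p ι (n + 1)) G')
    (hδ : ∀ g ∈ G, jetDelta p g ∈ Submodule.span (jetPoly p ι (n + 1)) G') {F : DiffPoly p ι}
    (hF : F ∈ Submodule.span (jetPoly p ι n) G) :
    F ∈ jetPoly p ι n ∧ F ∈ Submodule.span (jetPoly p ι (n + 1)) G' ∧
      jetDelta p F ∈ Submodule.span (jetPoly p ι (n + 1)) G' := by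
  have hm {n : ℕ} {a x : DiffPoly p ι} (ha : a ∈ jetPoly p ι n)
      {N : Submodule (jetPoly p ι n) (DiffPoly p ι)} (hx : x ∈ N) : a * x ∈ N :=
    N.smul_mem ⟨a, ha⟩ hx
  have hs := jetPoly_mono p (ι := ι) (Nat.le_succ n)
  induction hF using Submodule.span_induction with
  | mem g hg => exact ⟨hG g hg, hle g hg, hδ g hg⟩
  | zero => rw [jetDelta_zero]; exact ⟨zero_mem _, zero_mem _, zero_mem _⟩
  | add F F' _ _ ih ih' =>
    obtain ⟨r, hr, e⟩ := jetDelta_add_of_mem p ih.1 ih'.1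
    refine ⟨add_mem ih.1 ih'.1, add_mem ih.2.1 ih'.2.1, ?_⟩
    rw [e]
    exact sub_mem (add_mem ih.2.2 ih'.2.2) (hm (mul_mem (hs hr) (hs ih.1)) ih'.2.1)
  | smul a F _ ih =>
    have e : a • F = (a : DiffPoly p ι) * F := rfl
    refine ⟨e ▸ mul_mem a.2 ih.1, e ▸ hm (hs a.2) ih.2.1, ?_⟩
    rw [e, mul_comm, jetDelta_mul, mul_comm, ← pow_sub_one_mul hp.out.ne_zero F,
      mul_right_comm]
    exact add_mem (hm (jetPhi_mem p a.2) ih.2.2)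
      (hm (mul_mem (pow_mem (hs ih.1) _) (jetDelta_mem p a.2)) ih.2.1)

/-- The element `y` with `p * y = δ (V * W) - δ (p * W)` modulo `V ^ p - p ^ (p - 1) * V` and
`W ^ p - p * W * g`. -/
noncomputable def torsionElt (V W g : DiffPoly p ι) : DiffPoly p ι :=
  jetDelta p W * (jetDelta p V - 1 + (p : DiffPoly p ι) ^ (p - 2) * V) +
    W * (g * (jetDelta p V - 1 + (p : DiffPoly p ι) ^ (p - 1)))

/-- An identity in `R{x}`: expand `δ(V W)` by the product rule and `δ(p W) = φ(W) - p^(p-1) W^p`.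
The only terms not visibly divisible by `p` contain `W^p` or `V^p`, and the two subtracted
corrections trade these for multiples of `p`. -/
theorem natCast_mul_torsionElt (V W g : DiffPoly p ι) :
    (p : DiffPoly p ι) * torsionElt p V W g =
      jetDelta p (V * W) - jetDelta p ((p : DiffPoly p ι) * W) -
        (jetDelta p V - 1 + (p : DiffPoly p ι) ^ (p - 1)) * (W ^ p - (p : DiffPoly p ι) * W * g) -
        jetDelta p W * (V ^ p - (p : DiffPoly p ι) ^ (p - 1) * V) := by
  rw [jetDelta_mul, jetDelta_natCast_mul, jetPhi_eq p W, torsionElt, natCast_p_pow_pred]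
  ring

variable {p} in
-- Frobenius kills `p`-torsion modulo a `δ`-stable ideal: `δ(p F) = φ(F) - p^(p-1) F^p`, and the
-- last term is a multiple of `p F`.
theorem jetPhi_mem_of_natCast_mul_mem {J : Ideal (DiffPoly p ι)}
    (hJ : ∀ F ∈ J, jetDelta p F ∈ J) {F : DiffPoly p ι} (h : (p : DiffPoly p ι) * F ∈ J) : jetPhi p F ∈ J := by
  have h1 := hJ _ h
  rw [jetDelta_natCast_mul] at h1
  have h2 : (p : DiffPoly p ι) ^ (p - 1) * F ^ p ∈ J := by
    rw [natCast_p_pow_pred, ← mul_pow_sub_one hp.out.ne_zero F]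
    convert J.mul_mem_left ((p : DiffPoly p ι) ^ (p - 2) * F ^ (p - 1)) h using 1
    ring
  simpa using J.add_mem h1 h2

/-- The ideal generated by the first `s + 1` iterates of `δ` at `F`. -/
noncomputable def iterateIdeal (F : DiffPoly p ι) (s : ℕ) : Ideal (DiffPoly p ι) :=
  Ideal.span {G | ∃ a ≤ s, G = (jetDelta p)^[a] F}

theorem iterate_mem_iterateIdeal (F : DiffPoly p ι) {a s : ℕ} (h : a ≤ s) :
    (jetDelta p)^[a] F ∈ iterateIdeal p F s :=
  Ideal.subset_span ⟨a, h, rfl⟩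

theorem iterateIdeal_mono (F : DiffPoly p ι) {s t : ℕ} (h : s ≤ t) :
    iterateIdeal p F s ≤ iterateIdeal p F t :=
  Ideal.span_mono fun _ ⟨a, ha, e⟩ => ⟨a, ha.trans h, e⟩

theorem jetDelta_mem_iterateIdeal {F G : DiffPoly p ι} {s : ℕ} (h : G ∈ iterateIdeal p F s) :
    jetDelta p G ∈ iterateIdeal p F (s + 1) := by
  refine jetDelta_mem_of_span (iterateIdeal_mono p F (Nat.le_succ s)) ?_ h
  rintro _ ⟨a, ha, rfl⟩
  rw [← Function.iterate_succ_apply' (jetDelta p)]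
  exact iterate_mem_iterateIdeal p F (Nat.succ_le_succ ha)

/-- Only the leading term matters. By the product rule, `δ` turns `δ^(s+1) W · φ^s U` into `δ^(s+2)
W · φ^(s+1) U` plus a multiple of `(δ^(s+1) W)^p`, which the next ideal absorbs. -/
theorem jetDelta_iterate_mul_add_mem (W U T : DiffPoly p ι) (s : ℕ) :
    (jetDelta p)^[s] (jetDelta p W * U + W * T) -
      (jetDelta p)^[s + 1] W * (jetPhi p)^[s] U ∈ iterateIdeal p W s := by
  induction s with
  | zero => 
    have := Ideal.mul_mem_right T _ (iterate_mem_iterateIdeal p W (le_refl 0))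
    simpa using this
  | succ s ih =>
    set A := (jetDelta p)^[s + 1] W * (jetPhi p)^[s] U with hA
    obtain ⟨r, hr⟩ := jetDelta_add p ((jetDelta p)^[s] (jetDelta p W * U + W * T) - A) A
    rw [sub_add_cancel, ← Function.iterate_succ_apply' (jetDelta p)] at hr
    rw [hr, hA, jetDelta_mul, ← Function.iterate_succ_apply' (jetDelta p),
      ← Function.iterate_succ_apply' (jetPhi p), ← hA]
    have h1 := jetDelta_mem_iterateIdeal p ih
    have h2 := Ideal.mul_mem_right A _ (Ideal.mul_mem_left _ r (iterateIdeal_mono p W (Nat.le_succ s) ih))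
    have h3 := Ideal.mul_mem_right (jetDelta p ((jetPhi p)^[s] U)) _ (Ideal.pow_mem_of_mem _
      (iterate_mem_iterateIdeal p W (le_refl (s + 1))) p hp.out.pos)
    convert Ideal.sub_mem _ (Ideal.add_mem _ h1 h3) h2 using 1
    ring

variable {ι' : Type*} (a : MvPolynomial ι (ZpUr p) →ₐ[ZpUr p] MvPolynomial ι' (ZpUr p))

/-- The prolongation to differential polynomials of a homomorphism of polynomial algebras. -/
noncomputable def jetProlong : DiffPoly p ι →ₐ[ZpUr p] DiffPoly p ι' :=
  aeval fun j => (jetDelta p)^[j.2] (toDiffPoly p (a (X j.1)))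

theorem jetProlong_toDiffPoly (g : MvPolynomial ι (ZpUr p)) :
    jetProlong p a (toDiffPoly p g) = toDiffPoly p (a g) := by
  refine DFunLike.congr_fun (f := (jetProlong p a).comp (toDiffPoly p))
    (g := (toDiffPoly p).comp a) ?_ g
  ext i
  simp [jetProlong, toDiffPoly]

/-- Unlike `δ`, both composites are ring homomorphisms, so constants and variables suffice;
compatibility with `δ` then follows by cancelling `p`. -/
theorem jetProlong_jetPhi (F : DiffPoly p ι) :
    jetProlong p a (jetPhi p F) = jetPhi p (jetProlong p a F) := by
  refine DFunLike.congr_fun (f := (jetProlong p a).toRingHom.comp (jetPhi p))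
    (g := (jetPhi p).comp (jetProlong p a).toRingHom) ?_ F
  refine MvPolynomial.ringHom_ext (fun c => ?_) fun j => ?_
  · simp [jetPhi_C, jetProlong]
  · have h (j : ι × ℕ) : jetProlong p a (X j) = (jetDelta p)^[j.2] (toDiffPoly p (a (X j.1))) :=
      aeval_X _ _
    change jetProlong p a (jetPhi p (X j)) = jetPhi p (jetProlong p a (X j))
    rw [jetPhi_X, map_add, map_mul, map_pow, map_natCast, h, h, jetPhi_eq,
      Function.iterate_succ_apply']

theorem jetProlong_jetDelta (F : DiffPoly p ι) :
    jetProlong p a (jetDelta p F) = jetDelta p (jetProlong p a F) := by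
  refine (jetDelta_eq_of_mul_eq p ?_).symm
  rw [← jetProlong_jetPhi, ← map_pow, ← map_sub, ← jetDelta_spec, map_mul, map_natCast]

theorem jetProlong_jetDelta_iterate (F : DiffPoly p ι) (s : ℕ) :
    jetProlong p a ((jetDelta p)^[s] F) = (jetDelta p)^[s] (jetProlong p a F) :=
  (Function.Semiconj.iterate_right (fun F => jetProlong_jetDelta p a F) s) F

end DeltaCalculus

/-! ### Generators and relations of `W_m(R)` -/

section WittRing

variable (p : ℕ) [hp : Fact p.Prime] (m : ℕ)

/-- The Witt vector `(0, …, 0, 1, 0, …)` with `1` preceded by `i` zeros. -/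
noncomputable def wittVTilde (i : ℕ) : WittVector p (ZpUr p) :=
  WittVector.mk p fun j => if j = i then 1 else 0

theorem ghostComponent_wittVTilde (i n : ℕ) :
    WittVector.ghostComponent n (wittVTilde p i) = if i ≤ n then (p : ZpUr p) ^ i else 0 := by
  rw [WittVector.ghostComponent_apply, aeval_wittPolynomial]
  have h (k : ℕ) : (p : ZpUr p) ^ k * (wittVTilde p i).coeff k ^ p ^ (n - k) =
      if k = i then (p : ZpUr p) ^ i else 0 := by
    change (p : ZpUr p) ^ k * (if k = i then 1 else 0) ^ p ^ (n - k) = _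
    split_ifs with hk
    · rw [one_pow, mul_one, hk]
    · rw [zero_pow (pow_ne_zero _ hp.out.ne_zero), mul_zero]
  simp only [h, Finset.sum_ite_eq', Finset.mem_range, Nat.lt_succ_iff]

theorem ghostComponent_toWitt (a : ZpUr p) (n : ℕ) :
    WittVector.ghostComponent n (toWitt p a) = (frobR p)^[n] a :=
  ghostComponent_deltaCoeff p a n

theorem truncate_wittVTilde (i : ℕ) :
    WittVector.truncate (m + 1) (wittVTilde p i) = wittV p m i := by
  refine TruncatedWittVector.ext fun j => ?_
  rw [WittVector.coeff_truncate, wittV, TruncatedWittVector.coeff_mk]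
  rfl

theorem wittRing_algebraMap (c : ZpUr p) :
    algebraMap (ZpUr p) (WittRing p m) c = WittVector.truncate (m + 1) (toWitt p c) := rfl

theorem wittV_zero : wittV p m 0 = 1 := by
  rw [← truncate_wittVTilde, ← map_one (WittVector.truncate (m + 1))]
  congr 1
  refine ZpUr.ghost_ext p fun n => ?_
  rw [ghostComponent_wittVTilde, map_one, if_pos n.zero_le, pow_zero]

/-- The ghost components of the lift of `v_i` are `0` below index `i` and `p^i` from there on, so
the relation is read off componentwise. -/
theorem wittV_mul_wittV {i j : ℕ} (h : i ≤ j) :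
    wittV p m i * wittV p m j = (p : WittRing p m) ^ i * wittV p m j := by
  have key : wittVTilde p i * wittVTilde p j =
      (p : WittVector p (ZpUr p)) ^ i * wittVTilde p j := by
    refine ZpUr.ghost_ext p fun n => ?_
    rw [map_mul, map_mul, map_pow, map_natCast, ghostComponent_wittVTilde,
      ghostComponent_wittVTilde]
    by_cases hj : j ≤ n
    · rw [if_pos (h.trans hj)]
    · rw [if_neg hj, mul_zero, mul_zero]
  have := congrArg (WittVector.truncate (m + 1)) key
  rwa [map_mul, map_mul, map_pow, map_natCast, truncate_wittVTilde, truncate_wittVTilde] at this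

theorem frobR_bijective : Function.Bijective (frobR p) :=
  WittVector.frobenius_bijective p (AlgebraicClosure (ZMod p))

theorem wittVTilde_eq (i : ℕ) : wittVTilde p i = WittVector.verschiebung^[i] 1 := by
  refine WittVector.ext fun k => ?_
  change (if k = i then 1 else 0) = _
  rcases lt_or_ge k i with h | h
  · rw [WittVector.iterate_verschiebung_coeff_eq_zero _ h, if_neg h.ne]
  · obtain ⟨l, rfl⟩ := Nat.exists_eq_add_of_le' h
    rw [WittVector.iterate_verschiebung_coeff]
    rcases Nat.eq_zero_or_pos l with rfl | hl
    · simp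
    · rw [WittVector.one_coeff_eq_of_pos _ _ _ hl, if_neg (by omega)]

theorem ghostComponent_iterate_frobenius (x : WittVector p (ZpUr p)) (k n : ℕ) :
    WittVector.ghostComponent k (WittVector.frobenius^[n] x) =
      WittVector.ghostComponent (k + n) x := by
  induction n generalizing k with
  | zero => rfl
  | succ n ih => rw [Function.iterate_succ_apply', WittVector.ghostComponent_frobenius, ih,
      add_right_comm, add_assoc]

theorem exists_toWitt_sum (w : WittVector p (ZpUr p)) (n : ℕ) :
    ∃ c : ℕ → ZpUr p, ∀ k < n,
      (w - ∑ i ∈ Finset.range n, toWitt p (c i) * wittVTilde p i).coeff k = 0 := by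
  induction n with
  | zero => exact ⟨0, fun k hk => absurd hk k.not_lt_zero⟩
  | succ n ih =>
    obtain ⟨c, hc⟩ := ih
    set z := w - ∑ i ∈ Finset.range n, toWitt p (c i) * wittVTilde p i with hz
    -- The product of `V^n 1` with the image of `d` is `V^n` of a vector whose coefficient of index
    -- `0` is `φ^n d`; cancelling the `n`-th coefficient of `z` thus requires `φ^n d = z_n`.
    obtain ⟨d, hd⟩ := (frobR_bijective p).surjective.iterate n (z.coeff n)
    have hsum : ∑ i ∈ Finset.range n, toWitt p (Function.update c n d i) * wittVTilde p i =
        ∑ i ∈ Finset.range n, toWitt p (c i) * wittVTilde p i :=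
      Finset.sum_congr rfl fun i hi => by
        rw [Function.update_of_ne (Finset.mem_range.1 hi).ne]
    refine ⟨Function.update c n d, ?_⟩
    rw [Finset.sum_range_succ, hsum, Function.update_self, ← sub_sub, ← hz,
      mul_comm, wittVTilde_eq, WittVector.iterate_verschiebung_mul_left, one_mul,
      WittVector.eq_iterate_verschiebung hc]
    have hsub (x y : WittVector p (ZpUr p)) : WittVector.verschiebung^[n] x -
        WittVector.verschiebung^[n] y = WittVector.verschiebung^[n] (x - y) :=
      (iterate_map_sub WittVector.verschiebung n x y).symm
    intro k hk
    rw [hsub]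
    rcases Nat.lt_succ_iff_lt_or_eq.1 hk with h | rfl
    · exact WittVector.iterate_verschiebung_coeff_eq_zero _ h
    · have := WittVector.iterate_verschiebung_coeff (z.shift k -
        WittVector.frobenius^[k] (toWitt p d)) k 0
      rw [zero_add] at this
      have h0 (x : WittVector p (ZpUr p)) : WittVector.ghostComponent 0 x = x.coeff 0 := by
        rw [WittVector.ghostComponent_apply, aeval_wittPolynomial]; simp
      rw [this, ← h0, map_sub, ghostComponent_iterate_frobenius, zero_add, ghostComponent_toWitt,
        hd, h0, WittVector.shift_coeff, add_zero, sub_self]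

theorem exists_eq_sum_wittV (x : WittRing p m) :
    ∃ c : Fin (m + 1) → ZpUr p, ∑ i, c i • wittV p m i = x := by
  obtain ⟨w, rfl⟩ := WittVector.truncate_surjective p (m + 1) (ZpUr p) x
  obtain ⟨c, hc⟩ := exists_toWitt_sum p w (m + 1)
  refine ⟨fun i => c i, ?_⟩
  rw [← WittVector.mem_ker_truncate, RingHom.mem_ker, map_sub, sub_eq_zero, map_sum] at hc
  rw [hc, ← Fin.sum_univ_eq_sum_range (fun i => WittVector.truncate (m + 1)
    (toWitt p (c i) * wittVTilde p i)) (m + 1)]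
  refine Finset.sum_congr rfl fun i _ => ?_
  rw [map_mul, truncate_wittVTilde, Algebra.smul_def, wittRing_algebraMap]

/-- The ghost components of index `n ≤ m` give the triangular system `∑_{i ≤ n} p^i φ^n(c_i) = 0`,
solved inductively because `R` is a domain, `p ≠ 0` and `φ` is injective. -/
theorem eq_zero_of_sum_wittV (c : Fin (m + 1) → ZpUr p) (h : ∑ i, c i • wittV p m i = 0) :
    c = 0 := by
  have h1 : WittVector.truncate (m + 1) (∑ i, toWitt p (c i) * wittVTilde p i) = 0 := by
    rw [← h, map_sum]
    refine Finset.sum_congr rfl fun i _ => ?_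
    rw [map_mul, truncate_wittVTilde, Algebra.smul_def, wittRing_algebraMap]
  rw [← RingHom.mem_ker, WittVector.mem_ker_truncate] at h1
  have h2 : ∀ n < m + 1, ∑ i, (frobR p)^[n] (c i) * (if (i : ℕ) ≤ n then (p : ZpUr p) ^ (i : ℕ) else 0)
      = 0 := by
    intro n hn
    have h3 : WittVector.ghostComponent n (∑ i, toWitt p (c i) * wittVTilde p i) = 0 := by
      rw [WittVector.ghostComponent_apply, aeval_wittPolynomial]
      refine Finset.sum_eq_zero fun k hk => ?_
      have := Finset.mem_range.1 hk
      rw [h1 k (by omega), zero_pow (pow_ne_zero _ hp.out.ne_zero), mul_zero]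
    rw [map_sum] at h3
    refine Eq.trans ?_ h3
    refine Finset.sum_congr rfl fun i _ => ?_
    rw [map_mul, ghostComponent_toWitt, ghostComponent_wittVTilde]
  funext i
  obtain ⟨n, hn⟩ := i
  induction n using Nat.strong_induction_on with
  | _ n ih =>
    have h3 := h2 n hn
    rw [Finset.sum_eq_single ⟨n, hn⟩, if_pos le_rfl] at h3
    · refine (frobR_bijective p).injective.iterate n ?_
      rw [(mul_eq_zero.1 h3).resolve_right (pow_ne_zero _ (ZpUr.p_ne_zero p)), Pi.zero_apply,
        iterate_map_zero]
    · rintro ⟨k, hk⟩ - hne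
      rcases lt_or_ge n k with h | h
      · rw [if_neg (not_le.2 h), mul_zero]
      · rw [ih k (lt_of_le_of_ne h fun e => hne (Fin.ext e)) hk, Pi.zero_apply, iterate_map_zero,
          zero_mul]
    · simp

/-- The polynomial algebra with a variable for each of `v_1, …, v_m`. -/
abbrev WittPoly : Type := MvPolynomial (Set.Icc 1 m) (ZpUr p)

/-- The map from the polynomial algebra to `W_m(R)` sending the variables to the `v_i`. -/
noncomputable def wittEval : WittPoly p m →ₐ[ZpUr p] WittRing p m :=
  aeval fun i => wittV p m i

open Classical in
/-- The monomials `1, X_1, …, X_m`. -/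
noncomputable def wittMonomial (i : Fin (m + 1)) : WittPoly p m :=
  if h : (i : ℕ) ∈ Set.Icc 1 m then X ⟨i, h⟩ else 1

theorem wittMonomial_coe (i : Set.Icc 1 m) :
    wittMonomial p m ⟨i, Nat.lt_succ_of_le i.2.2⟩ = X i := dif_pos i.2

theorem wittMonomial_zero : wittMonomial p m 0 = 1 := dif_neg (by simp)

theorem wittEval_wittMonomial (i : Fin (m + 1)) :
    wittEval p m (wittMonomial p m i) = wittV p m i := by
  unfold wittMonomial
  split_ifs with h
  · exact aeval_X _ _
  · have : (i : ℕ) = 0 := by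
      have := i.2
      simp only [Set.mem_Icc, not_and_or] at h
      omega
    rw [this, map_one, wittV_zero]

theorem wittEval_surjective : Function.Surjective (wittEval p m) := fun x => by
  obtain ⟨c, rfl⟩ := exists_eq_sum_wittV p m x
  refine ⟨∑ i, c i • wittMonomial p m i, ?_⟩
  simp only [map_sum, map_smul, wittEval_wittMonomial]

/-- The ideal of the relations `v_i v_j = p ^ i v_j`, `i ≤ j`. -/
noncomputable def wittRelations : Ideal (WittPoly p m) :=
  Ideal.span {f | ∃ i j : Set.Icc 1 m, i ≤ j ∧
    f = X i * X j - (p : WittPoly p m) ^ (i : ℕ) * X j}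

/-- By commutativity the relations with `i ≤ j` rewrite every product of two variables as a multiple
of a single variable. -/
theorem mem_span_sup_wittRelations (f : WittPoly p m) :
    f ∈ Submodule.span (ZpUr p) (Set.range (wittMonomial p m)) ⊔
      (wittRelations p m).restrictScalars (ZpUr p) := by
  set L := Submodule.span (ZpUr p) (Set.range (wittMonomial p m))
  have hX (i : Set.Icc 1 m) : (X i : WittPoly p m) ∈ L :=
    Submodule.subset_span ⟨_, wittMonomial_coe p m i⟩
  have hXX {i j : Set.Icc 1 m} (h : i ≤ j) : (X i * X j : WittPoly p m) ∈ L ⊔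
      (wittRelations p m).restrictScalars (ZpUr p) := by
    rw [← sub_add_cancel (X i * X j : WittPoly p m) ((p : WittPoly p m) ^ (i : ℕ) * X j)]
    refine add_mem (Submodule.mem_sup_right (Ideal.subset_span ⟨i, j, h, rfl⟩))
      (Submodule.mem_sup_left ?_)
    have e : (p : WittPoly p m) ^ (i : ℕ) * X j = ((p : ZpUr p) ^ (i : ℕ)) • X j := by
      simp [smul_eq_C_mul]
    rw [e]
    exact L.smul_mem _ (hX j)
  induction f using MvPolynomial.induction_on with
  | C c =>
    refine Submodule.mem_sup_left ?_
    rw [← mul_one (C c), ← smul_eq_C_mul]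
    exact L.smul_mem _ (Submodule.subset_span ⟨0, wittMonomial_zero p m⟩)
  | add f g hf hg => exact add_mem hf hg
  | mul_X f j hf =>
    obtain ⟨l, hl, e, he, rfl⟩ := Submodule.mem_sup.1 hf
    rw [add_mul]
    refine add_mem ?_ (Submodule.mem_sup_right (Ideal.mul_mem_right (X j) _ he))
    clear hf
    induction hl using Submodule.span_induction with
    | mem l hl =>
      obtain ⟨i, rfl⟩ := hl
      unfold wittMonomial
      split_ifs with h
      · rcases le_total (⟨i, h⟩ : Set.Icc 1 m) j with hij | hij
        · exact hXX hij
        · rw [mul_comm]; exact hXX hij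
      · rw [one_mul]; exact Submodule.mem_sup_left (hX j)
    | zero => rw [zero_mul]; exact zero_mem _
    | add l l' _ _ h h' =>
      rw [add_mul]
      exact add_mem h h'
    | smul c l _ h =>
      rw [smul_mul_assoc]
      exact Submodule.smul_mem _ _ h

theorem wittEval_of_mem_wittRelations {f : WittPoly p m} (hf : f ∈ wittRelations p m) :
    wittEval p m f = 0 := by
  have : wittRelations p m ≤ RingHom.ker (wittEval p m) := by
    refine Ideal.span_le.2 ?_
    rintro _ ⟨i, j, h, rfl⟩
    rw [SetLike.mem_coe, RingHom.mem_ker, map_sub, map_mul, map_mul, map_pow, map_natCast, wittEval,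
      aeval_X, aeval_X, wittV_mul_wittV p m h, sub_self]
  exact this hf

/-- After reduction to a combination of `1, X_1, …, X_m`, linear independence of `1, v_1, …, v_m`
makes the coefficients vanish. -/
theorem mem_wittRelations_of_wittEval {f : WittPoly p m} (hf : wittEval p m f = 0) :
    f ∈ wittRelations p m := by
  obtain ⟨l, hl, e, he, rfl⟩ := Submodule.mem_sup.1 (mem_span_sup_wittRelations p m f)
  obtain ⟨c, rfl⟩ := (Submodule.mem_span_range_iff_exists_fun _).1 hl
  rw [map_add, wittEval_of_mem_wittRelations p m he, add_zero, map_sum] at hf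
  simp only [map_smul, wittEval_wittMonomial] at hf
  rw [eq_zero_of_sum_wittV p m c hf]
  simpa using he

end WittRing

/-! ### The limit ring satisfies all the jet relations -/

section LimitRing

variable (p : ℕ) [hp : Fact p.Prime] (m : ℕ)

/-- The reduction map from `R{v}` to the limit ring. -/
noncomputable def toLimitRing : DiffPoly p (Set.Icc 1 m) →+* LimitRing p m :=
  (Ideal.Quotient.mk (limitIdeal p m)).comp (map (Ideal.Quotient.mk (Ideal.span {(p : ZpUr p)})))

theorem toLimitRing_X (j : Set.Icc 1 m × ℕ) :
    toLimitRing p m (X j) = Ideal.Quotient.mk (limitIdeal p m) (X j) := by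
  rw [toLimitRing, RingHom.comp_apply, map_X]

theorem toLimitRing_C (c : ZpUr p) :
    toLimitRing p m (C c) =
      Ideal.Quotient.mk (limitIdeal p m) (C (Ideal.Quotient.mk (Ideal.span {(p : ZpUr p)}) c)) := by
  rw [toLimitRing, RingHom.comp_apply, map_C]

theorem toLimitRing_surjective : Function.Surjective (toLimitRing p m) :=
  Ideal.Quotient.mk_surjective.comp (map_surjective _ Ideal.Quotient.mk_surjective)

theorem limitRing_natCast_p : (p : LimitRing p m) = 0 := by
  have h : (Ideal.Quotient.mk (Ideal.span {(p : ZpUr p)})) (p : ZpUr p) = 0 :=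
    Ideal.Quotient.eq_zero_iff_mem.2 (Ideal.mem_span_singleton_self _)
  have := toLimitRing_C p m (p : ZpUr p)
  rwa [h, map_zero, map_zero, map_natCast, map_natCast] at this

theorem toLimitRing_X_mul_X (i j : Set.Icc 1 m) :
    toLimitRing p m (X (i, 0) * X (j, 0)) = 0 := by
  rw [map_mul, toLimitRing_X, toLimitRing_X, ← map_mul]
  exact Ideal.Quotient.eq_zero_iff_mem.2 (Ideal.subset_span (Or.inl ⟨i, j, rfl⟩))

theorem toLimitRing_X_pow (j : Set.Icc 1 m × ℕ) : toLimitRing p m (X j ^ p) = 0 := by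
  obtain ⟨i, r⟩ := j
  rcases Nat.eq_zero_or_pos r with rfl | hr
  · rw [map_pow]
    exact pow_eq_zero_of_le hp.out.two_le (by rw [sq, ← map_mul, toLimitRing_X_mul_X])
  · rw [map_pow, toLimitRing_X, ← map_pow]
    exact Ideal.Quotient.eq_zero_iff_mem.2 (Ideal.subset_span (Or.inr ⟨i, r, hr, rfl⟩))

/-- A `δ`-stable ideal of `R{v}` which contains the relations of `W_m(R)` and vanishes in the limit
ring. -/
noncomputable def limitDeltaIdeal : Ideal (DiffPoly p (Set.Icc 1 m)) :=
  Ideal.span ({F | ∃ j, F = (p : DiffPoly p (Set.Icc 1 m)) * X j} ∪ {F | ∃ j, F = X j ^ p} ∪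
    {F | ∃ i j, F = X (i, 0) * X (j, 0)})

theorem limitDeltaIdeal_le_ker : limitDeltaIdeal p m ≤ RingHom.ker (toLimitRing p m) := by
  refine Ideal.span_le.2 ?_
  rintro _ ((⟨j, rfl⟩ | ⟨j, rfl⟩) | ⟨i, j, rfl⟩)
  · rw [SetLike.mem_coe, RingHom.mem_ker, map_mul, map_natCast, limitRing_natCast_p, zero_mul]
  · exact toLimitRing_X_pow p m j
  · exact toLimitRing_X_mul_X p m i j

theorem p_mul_X_mem_limitDeltaIdeal (j : Set.Icc 1 m × ℕ) :
    (p : DiffPoly p (Set.Icc 1 m)) * X j ∈ limitDeltaIdeal p m :=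
  Ideal.subset_span (Or.inl (Or.inl ⟨j, rfl⟩))

theorem X_pow_mem_limitDeltaIdeal (j : Set.Icc 1 m × ℕ) :
    (X j : DiffPoly p (Set.Icc 1 m)) ^ p ∈ limitDeltaIdeal p m :=
  Ideal.subset_span (Or.inl (Or.inr ⟨j, rfl⟩))

theorem jetPhi_X_mem_limitDeltaIdeal (j : Set.Icc 1 m × ℕ) :
    jetPhi p (X j) ∈ limitDeltaIdeal p m := by
  rw [jetPhi_X]
  exact add_mem (X_pow_mem_limitDeltaIdeal p m j) (p_mul_X_mem_limitDeltaIdeal p m _)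

/-- In `(F^p + p δF)^p - F^(p^2)` every term is divisible by `p · (p δF)`, so one factor `p`
survives the division defining `δ`. -/
theorem jetDelta_pow_p {ι : Type*} (F : DiffPoly p ι) :
    ∃ G, jetDelta p (F ^ p) = G * ((p : DiffPoly p ι) * jetDelta p F) := by
  obtain ⟨r, hr⟩ := exists_add_pow_prime_eq hp.out (F ^ p) ((p : DiffPoly p ι) * jetDelta p F)
  refine ⟨(p : DiffPoly p ι) ^ (p - 2) * jetDelta p F ^ (p - 1) + F ^ p * r, ?_⟩
  refine jetDelta_eq_of_mul_eq p ?_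
  rw [map_pow, jetPhi_eq, hr, mul_pow, ← pow_sub_one_mul hp.out.ne_zero (jetDelta p F),
    ← pow_sub_one_mul hp.out.ne_zero (p : DiffPoly p ι), natCast_p_pow_pred]
  ring

/-- The three families of generators feed one another: `φ(x^(r)) = (x^(r))^p + p x^(r+1)` lies in
the ideal, `δ((x^(r))^p)` is a multiple of `p x^(r+1)`, and `δ(x_i x_j) = δx_i · φ(x_j) + x_i^p ·
δx_j`. -/
theorem jetDelta_mem_limitDeltaIdeal (F : DiffPoly p (Set.Icc 1 m)) (hF : F ∈ limitDeltaIdeal p m) :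
    jetDelta p F ∈ limitDeltaIdeal p m := by
  refine jetDelta_mem_of_span le_rfl ?_ hF
  rintro _ ((⟨j, rfl⟩ | ⟨j, rfl⟩) | ⟨i, j, rfl⟩)
  · rw [jetDelta_natCast_mul]
    exact sub_mem (jetPhi_X_mem_limitDeltaIdeal p m j)
      (Ideal.mul_mem_left _ _ (X_pow_mem_limitDeltaIdeal p m j))
  · obtain ⟨G, hG⟩ := jetDelta_pow_p p (X j : DiffPoly p (Set.Icc 1 m))
    obtain ⟨i, r⟩ := j
    rw [hG, jetDelta_X]
    exact Ideal.mul_mem_left _ _ (p_mul_X_mem_limitDeltaIdeal p m _)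
  · rw [jetDelta_mul]
    exact add_mem (Ideal.mul_mem_left _ _ (jetPhi_X_mem_limitDeltaIdeal p m _))
      (Ideal.mul_mem_right _ _ (X_pow_mem_limitDeltaIdeal p m _))

theorem toDiffPoly_mem_limitDeltaIdeal {f : WittPoly p m} (hf : wittEval p m f = 0) :
    toDiffPoly p f ∈ limitDeltaIdeal p m := by
  have h : wittRelations p m ≤ (limitDeltaIdeal p m).comap (toDiffPoly p) := by
    refine Ideal.span_le.2 ?_
    rintro _ ⟨i, j, -, rfl⟩
    have hX (i : Set.Icc 1 m) : toDiffPoly p (X i) = X (i, 0) := rename_X _ _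
    rw [SetLike.mem_coe, Ideal.mem_comap, map_sub, map_mul, map_mul, map_pow, map_natCast, hX, hX,
      ← pow_sub_one_mul (Nat.one_le_iff_ne_zero.1 i.2.1), mul_assoc]
    exact sub_mem (Ideal.subset_span (Or.inr ⟨i, j, rfl⟩))
      (Ideal.mul_mem_left _ _ (p_mul_X_mem_limitDeltaIdeal p m _))
  exact h (mem_wittRelations_of_wittEval p m hf)

theorem toLimitRing_jetDelta_iterate_eq {f g : WittPoly p m} (h : wittEval p m f = wittEval p m g)
    (s : ℕ) : toLimitRing p m ((jetDelta p)^[s] (toDiffPoly p f)) =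
      toLimitRing p m ((jetDelta p)^[s] (toDiffPoly p g)) := by
  rw [← sub_eq_zero, ← map_sub]
  refine limitDeltaIdeal_le_ker p m
    (jetDelta_iterate_sub_mem (jetDelta_mem_limitDeltaIdeal p m) ?_ s)
  rw [← map_sub]
  exact toDiffPoly_mem_limitDeltaIdeal p m (by rw [map_sub, h, sub_self])

end LimitRing

/-! ### Nilpotence and idempotence from `p`-torsion -/

section Nilpotence

variable {p : ℕ} [hp : Fact p.Prime] {ι : Type*} {T : Type*} [CommRing T]

theorem map_jetPhi_of_natCast_eq_zero (hT : (p : T) = 0) (γ : DiffPoly p ι →+* T)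
    (F : DiffPoly p ι) : γ (jetPhi p F) = γ F ^ p := by
  rw [jetPhi_eq, map_add, map_mul, map_natCast, hT, zero_mul, add_zero, map_pow]

theorem map_jetPhi_iterate_of_natCast_eq_zero (hT : (p : T) = 0) (γ : DiffPoly p ι →+* T)
    (F : DiffPoly p ι) (s : ℕ) : γ ((jetPhi p)^[s] F) = γ F ^ p ^ s := by
  induction s with
  | zero => simp
  | succ s ih =>
    rw [Function.iterate_succ_apply', map_jetPhi_of_natCast_eq_zero hT, ih, ← pow_mul, pow_succ]

theorem natCast_mul_torsionElt_mem {J : Ideal (DiffPoly p ι)}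
    (hJ : ∀ F ∈ J, jetDelta p F ∈ J) {V W g : DiffPoly p ι}
    (hV : V * V - (p : DiffPoly p ι) * V ∈ J) (hVW : V * W - (p : DiffPoly p ι) * W ∈ J)
    (hW : W ^ p - (p : DiffPoly p ι) * W * g ∈ J) :
    (p : DiffPoly p ι) * torsionElt p V W g ∈ J := by
  rw [natCast_mul_torsionElt]
  refine sub_mem (sub_mem (jetDelta_sub_mem hJ hVW) (J.mul_mem_left _ hW)) (J.mul_mem_left _ ?_)
  obtain ⟨c, hc⟩ := sub_dvd_pow_sub_pow V (p : DiffPoly p ι) (p - 1)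
  rw [← pow_sub_one_mul hp.out.ne_zero V, ← sub_mul, hc]
  convert J.mul_mem_left c hV using 1
  ring

/-- Since `φ(y)` lies in `J` for the torsion element `y`, so do all `δ^s φ(y) = φ(δ^s y)`, whence
`γ(δ^s y)^p = 0`. Modulo lower iterates of `W`, `δ^s y` is `δ^(s+1) W` times a factor that becomes a
unit, and strong induction on `s` applies. -/
theorem map_jetDelta_iterate_pow_eq_zero (hT : (p : T) = 0) (γ : DiffPoly p ι →+* T)
    {J : Ideal (DiffPoly p ι)} (hJ : ∀ F ∈ J, jetDelta p F ∈ J) (hγ : J ≤ RingHom.ker γ)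
    {V W g : DiffPoly p ι}
    (hV : V * V - (p : DiffPoly p ι) * V ∈ J) (hVW : V * W - (p : DiffPoly p ι) * W ∈ J)
    (hW : W ^ p - (p : DiffPoly p ι) * W * g ∈ J) (hu : IsUnit (γ (jetDelta p V - 1))) (s : ℕ) :
    γ ((jetDelta p)^[s] W) ^ p = 0 := by
  -- Since `p = 0` in `T`, `γ(φ F) = γ(F)^p`; as a kernel, the set where this vanishes is visibly an
  -- ideal.
  set Z : Ideal (DiffPoly p ι) := RingHom.ker (γ.comp (jetPhi p)) with hZ
  have hmem {F : DiffPoly p ι} : F ∈ Z ↔ γ F ^ p = 0 := by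
    rw [hZ, RingHom.mem_ker, RingHom.comp_apply, map_jetPhi_of_natCast_eq_zero hT]
  have hy (s : ℕ) : (jetDelta p)^[s] (torsionElt p V W g) ∈ Z := by
    rw [hZ, RingHom.mem_ker, RingHom.comp_apply, ← jetPhi_jetDelta_iterate]
    exact hγ (jetDelta_iterate_ideal_mem hJ (jetPhi_mem_of_natCast_mul_mem hJ
      (natCast_mul_torsionElt_mem hJ hV hVW hW)) s)
  have hVp : γ V ^ p = 0 := by
    have h : γ V * γ V = 0 := by
      have := hγ hV
      rwa [RingHom.mem_ker, map_sub, map_mul, map_mul, map_natCast, hT, zero_mul, sub_zero] at this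
    exact pow_eq_zero_of_le hp.out.two_le (by rw [sq, h])
  have hunit (s : ℕ) : IsUnit (γ (jetPhi p ((jetPhi p)^[s]
      (jetDelta p V - 1 + (p : DiffPoly p ι) ^ (p - 2) * V)))) := by
    rw [← Function.iterate_succ_apply' (jetPhi p), Function.iterate_succ_apply,
      map_jetPhi_iterate_of_natCast_eq_zero hT, map_add, map_mul, map_add, map_mul,
      map_jetPhi_of_natCast_eq_zero hT, map_jetPhi_of_natCast_eq_zero hT γ V, hVp, mul_zero,
      add_zero]
    exact (hu.pow p).pow _
  rw [← hmem]
  induction s using Nat.strong_induction_on with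
  | _ s ih =>
    cases s with
    | zero =>
      have := hγ hW
      rw [RingHom.mem_ker, map_sub, map_mul, map_mul, map_natCast, hT, zero_mul, zero_mul, sub_zero,
        map_pow] at this
      exact hmem.2 this
    | succ s =>
      have hle : iterateIdeal p W s ≤ Z := by
        refine Ideal.span_le.2 ?_
        rintro _ ⟨a, ha, rfl⟩
        exact ih a (Nat.lt_succ_of_le ha)
      have h1 := sub_mem (hy s) (hle (jetDelta_iterate_mul_add_mem p W
        (jetDelta p V - 1 + (p : DiffPoly p ι) ^ (p - 2) * V)
        (g * (jetDelta p V - 1 + (p : DiffPoly p ι) ^ (p - 1))) s))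
      rw [torsionElt, sub_sub_cancel, hZ, RingHom.mem_ker, RingHom.comp_apply, map_mul, map_mul,
        (hunit s).mul_left_eq_zero] at h1
      exact h1

variable {κ : Type*} (f : κ → MvPolynomial ι (ZpUr p))

/-- The torsion relation `p y = 0` holds in order `1`, and one more `δ` gives `φ(y) = 0` in order
`2`; this is why order `2` suffices. The submodules `N n` keep track of the order. -/
theorem isIdempotentElem_map_one_sub_pow (hT : (p : T) = 0) (θ : jetPoly p ι 2 →+* T)
    (hθ : ∀ (r : ℕ) (h : r ≤ 2) (s : κ), θ (jetDeltaIter p (f s) h) = 0)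
    {v : MvPolynomial ι (ZpUr p)} (hv : v * v - (p : MvPolynomial ι (ZpUr p)) * v ∈
      Ideal.span (Set.range f)) :
    IsIdempotentElem (θ ((1 - jetDeltaIter p v one_le_two) ^ p)) := by
  let G (n : ℕ) : Set (DiffPoly p ι) := {F | ∃ r ≤ n, ∃ s, F = (jetDelta p)^[r] (toDiffPoly p (f s))}
  let N (n : ℕ) : Submodule (jetPoly p ι n) (DiffPoly p ι) := Submodule.span _ (G n)
  have hm {n : ℕ} {a x : DiffPoly p ι} (ha : a ∈ jetPoly p ι n) (hx : x ∈ N n) : a * x ∈ N n :=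
    (N n).smul_mem ⟨a, ha⟩ hx
  have hN {n : ℕ} {F : DiffPoly p ι} (hF : F ∈ N n) :
      F ∈ jetPoly p ι n ∧ F ∈ N (n + 1) ∧ jetDelta p F ∈ N (n + 1) := by
    refine jetDelta_mem_of_span_jetPoly ?_ ?_ ?_ hF
    · rintro _ ⟨r, hr, s, rfl⟩
      exact jetDelta_iterate_mem p _ hr
    · rintro _ ⟨r, hr, s, rfl⟩
      exact Submodule.subset_span ⟨r, hr.trans n.le_succ, s, rfl⟩
    · rintro _ ⟨r, hr, s, rfl⟩
      exact Submodule.subset_span ⟨r + 1, Nat.succ_le_succ hr, s,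
        (Function.iterate_succ_apply' _ _ _).symm⟩
  have hθN (F : jetPoly p ι 2) (hF : (F : DiffPoly p ι) ∈ N 2) : θ F = 0 := by
    have key : ∀ F ∈ N 2, ∃ h : F ∈ jetPoly p ι 2, θ ⟨F, h⟩ = 0 := by
      intro F hF
      induction hF using Submodule.span_induction with
      | mem F hF =>
        obtain ⟨r, hr, s, rfl⟩ := hF
        exact ⟨_, hθ r hr s⟩
      | zero => exact ⟨zero_mem _, map_zero θ⟩
      | add x y _ _ hx hy =>
        obtain ⟨hx, hx'⟩ := hx
        obtain ⟨hy, hy'⟩ := hy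
        refine ⟨add_mem hx hy, ?_⟩
        have := map_add θ ⟨x, hx⟩ ⟨y, hy⟩
        rwa [hx', hy', add_zero] at this
      | smul a x _ hx =>
        obtain ⟨hx, hx'⟩ := hx
        refine ⟨mul_mem a.2 hx, ?_⟩
        have := map_mul θ a ⟨x, hx⟩
        rwa [hx', mul_zero] at this
    exact (key F hF).2
  have h0 (g : MvPolynomial ι (ZpUr p)) : toDiffPoly p g ∈ jetPoly p ι 0 :=
    jetDelta_iterate_mem p g (le_refl 0)
  set V := toDiffPoly p v with hVdef
  have hV0 : V ∈ jetPoly p ι 0 := h0 v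
  have hV1 : V ∈ jetPoly p ι 1 := jetPoly_mono p zero_le_one hV0
  have hd1 : jetDelta p V ∈ jetPoly p ι 1 := jetDelta_mem p hV0
  have hp1 : (p : DiffPoly p ι) ∈ jetPoly p ι 1 := natCast_mem _ p
  have hVV : V * V - (p : DiffPoly p ι) * V ∈ N 0 := by
    have : ∀ g ∈ Ideal.span (Set.range f), toDiffPoly p g ∈ N 0 := by
      intro g hg
      induction hg using Submodule.span_induction with
      | mem g hg =>
        obtain ⟨s, rfl⟩ := hg
        exact Submodule.subset_span ⟨0, le_rfl, s, rfl⟩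
      | zero => rw [map_zero]; exact zero_mem _
      | add x y _ _ hx hy => rw [map_add]; exact add_mem hx hy
      | smul a x _ hx => rw [smul_eq_mul, map_mul]; exact hm (h0 a) hx
    simpa [hVdef] using this _ hv
  have hVp : V ^ p - (p : DiffPoly p ι) ^ (p - 1) * V ∈ N 0 := by
    obtain ⟨c, hc⟩ := sub_dvd_pow_sub_pow (⟨V, hV0⟩ : jetPoly p ι 0) (p : jetPoly p ι 0) (p - 1)
    have hc' := congrArg Subtype.val hc
    push_cast at hc'
    rw [← pow_sub_one_mul hp.out.ne_zero V, ← sub_mul, hc']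
    convert hm c.2 hVV using 1
    ring
  -- Here `W = V`, and `V^p = p^(p-1) V = p V · p^(p-2)` dictates the last argument.
  set y := torsionElt p V V ((p : DiffPoly p ι) ^ (p - 2)) with hy
  have hpy : (p : DiffPoly p ι) * y ∈ N 1 := by
    rw [hy, natCast_mul_torsionElt]
    have hVp1 := (hN hVp).2.1
    refine sub_mem (sub_mem ?_ (hm (add_mem (sub_mem hd1 (one_mem _)) (pow_mem hp1 _)) ?_))
      (hm hd1 hVp1)
    · obtain ⟨r, hr, e⟩ := jetDelta_add_of_mem p (hN hVV).1
        (mul_mem (natCast_mem _ p) hV0 : (p : DiffPoly p ι) * V ∈ jetPoly p ι 0)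
      rw [sub_add_cancel] at e
      rw [e]
      convert sub_mem (hN hVV).2.2 ((hN (hm (mul_mem hr (mul_mem (natCast_mem _ p) hV0)) hVV)).2.1)
        using 1
      ring
    · rwa [mul_right_comm, ← natCast_p_pow_pred]
  have hy1 : y ∈ jetPoly p ι 1 :=
    add_mem (mul_mem hd1 (add_mem (sub_mem hd1 (one_mem _)) (mul_mem (pow_mem hp1 _) hV1)))
      (mul_mem hV1 (mul_mem (pow_mem hp1 _) (add_mem (sub_mem hd1 (one_mem _)) (pow_mem hp1 _))))
  have h12 := jetPoly_mono p (ι := ι) one_le_two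
  let v2 : jetPoly p ι 2 := ⟨V, h12 hV1⟩
  let d2 : jetPoly p ι 2 := jetDeltaIter p v one_le_two
  let y2 : jetPoly p ι 2 := d2 * (d2 - 1 + (p : jetPoly p ι 2) ^ (p - 2) * v2) +
    v2 * ((p : jetPoly p ι 2) ^ (p - 2) * (d2 - 1 + (p : jetPoly p ι 2) ^ (p - 1)))
  have hy2 : (y2 : DiffPoly p ι) = y := by
    simp only [y2, hy, torsionElt]
    push_cast
    rfl
  have hθy : θ y2 ^ p = 0 := by
    have h1 := (hN hpy).2.2
    rw [jetDelta_natCast_mul, jetPhi_eq] at h1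
    have h2 := hθN (y2 ^ p + (p : jetPoly p ι 2) * ⟨jetDelta p y, jetDelta_mem p hy1⟩ -
      (p : jetPoly p ι 2) ^ (p - 1) * y2 ^ p) (by push_cast; rw [hy2]; exact h1)
    rwa [map_sub, map_add, map_mul, map_mul, map_pow, map_pow, map_natCast, hT,
      zero_pow (Nat.sub_ne_zero_of_lt hp.out.one_lt), zero_mul, zero_mul, add_zero, sub_zero] at h2
  have hθv : θ v2 ^ p = 0 := by
    have h1 := hθN (v2 ^ p - (p : jetPoly p ι 2) ^ (p - 1) * v2)
      (by push_cast; exact (hN (hN hVp).2.1).2.1)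
    rwa [map_sub, map_mul, map_pow, map_pow, map_natCast, hT,
      zero_pow (Nat.sub_ne_zero_of_lt hp.out.one_lt), zero_mul, sub_zero] at h1
  rcases subsingleton_or_nontrivial T with hsub | hnon
  · exact Subsingleton.elim _ _
  have : CharP T p := (CharP.charP_iff_prime_eq_zero hp.out).2 hT
  have h3 : θ y2 = θ d2 ^ 2 - θ d2 + θ v2 * ((p : T) ^ (p - 2) * θ d2 +
      (p : T) ^ (p - 2) * (θ d2 - 1 + (p : T) ^ (p - 1))) := by
    simp only [y2, map_add, map_mul, map_sub, map_pow, map_one, map_natCast]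
    ring
  -- In characteristic `p` the `p`-th power is additive, so the multiple of `V` dies and `y^p = 0`
  -- becomes `(d^2)^p = d^p` with `d = δV`.
  rw [h3, add_pow_char, mul_pow, hθv, zero_mul, add_zero, sub_pow_char, sub_eq_zero] at hθy
  rw [map_pow, map_sub, map_one, sub_pow_char, one_pow]
  refine IsIdempotentElem.one_sub ?_
  rw [IsIdempotentElem, ← sq, pow_right_comm, hθy]

end Nilpotence

/-! ### Maps from `p`-adic completions to rings in which `p = 0` -/

section PCompletion

theorem toPCompletion_evalOne {p : ℕ} {A : Type*} [CommRing A] (a : A) :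
    AdicCompletion.evalOneₐ (Ideal.span {(p : A)}) (toPCompletion p A a) =
      Ideal.Quotient.mk (Ideal.span {(p : A)}) a :=
  DFunLike.congr_fun (AdicCompletion.evalOneₐ_comp_algebraMap_eq_mk (Ideal.span {(p : A)})) a

variable {p : ℕ} {A T : Type*} [CommRing A] [CommRing T]

/-- As `(p)` is finitely generated, the kernel of the reduction of the completion to `A/p` is
generated by `p`. Maps to rings with `p = 0` are therefore determined on `A`. -/
theorem exists_eq_toPCompletion_add (x : PCompletion p A) :
    ∃ (a : A) (y : PCompletion p A), x = toPCompletion p A a + (p : PCompletion p A) * y := by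
  obtain ⟨a, ha⟩ := Ideal.Quotient.mk_surjective
    (AdicCompletion.evalOneₐ (Ideal.span {(p : A)}) x)
  have h : x - toPCompletion p A a ∈
      RingHom.ker (AdicCompletion.evalOneₐ (Ideal.span {(p : A)})).toRingHom := by
    rw [RingHom.mem_ker, map_sub, sub_eq_zero]
    exact ha.symm.trans (toPCompletion_evalOne a).symm
  rw [AdicCompletion.ker_evalOneₐ_eq_map _ (Submodule.fg_span_singleton _), Ideal.map_span,
    Set.image_singleton, map_natCast, Ideal.mem_span_singleton] at h
  obtain ⟨y, hy⟩ := h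
  exact ⟨a, y, by rw [← hy]; ring⟩

theorem pCompletion_ringHom_ext (hT : (p : T) = 0) {g₁ g₂ : PCompletion p A →+* T}
    (h : ∀ a, g₁ (toPCompletion p A a) = g₂ (toPCompletion p A a)) : g₁ = g₂ := by
  ext x
  obtain ⟨a, y, rfl⟩ := exists_eq_toPCompletion_add x
  rw [map_add, map_add, h, map_mul, map_mul, map_natCast, map_natCast, hT, zero_mul, zero_mul]

theorem exists_pCompletion_lift (hT : (p : T) = 0) (g : A →+* T) :
    ∃ Φ : PCompletion p A →+* T, ∀ a, Φ (toPCompletion p A a) = g a := by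
  refine ⟨(Ideal.Quotient.lift (Ideal.span {(p : A)}) g fun a ha => ?_).comp
    (AdicCompletion.evalOneₐ (Ideal.span {(p : A)})).toRingHom, fun a => ?_⟩
  · obtain ⟨b, rfl⟩ := Ideal.mem_span_singleton.1 ha
    rw [map_mul, map_natCast, hT, zero_mul]
  · rw [RingHom.comp_apply, AlgHom.toRingHom_eq_coe, RingHom.coe_coe, toPCompletion_evalOne,
      Ideal.Quotient.lift_mk]

/-- The map from `A` to the reduction modulo `p` of a quotient of its `p`-adic completion. -/
noncomputable def toReduction (I : Ideal (PCompletion p A)) :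
    A →+* (PCompletion p A ⧸ I) ⧸ Ideal.span {(p : PCompletion p A ⧸ I)} :=
  (Ideal.Quotient.mk _).comp ((Ideal.Quotient.mk I).comp (toPCompletion p A))

theorem reduction_natCast_p {C : Type*} [CommRing C] (p : ℕ) :
    (p : C ⧸ Ideal.span {(p : C)}) = 0 := by
  rw [← map_natCast (Ideal.Quotient.mk (Ideal.span {(p : C)}))]
  exact Ideal.Quotient.eq_zero_iff_mem.2 (Ideal.mem_span_singleton_self _)

theorem reduction_ringHom_ext {I : Ideal (PCompletion p A)}
    {g₁ g₂ : (PCompletion p A ⧸ I) ⧸ Ideal.span {(p : PCompletion p A ⧸ I)} →+* T}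
    (h : ∀ a, g₁ (toReduction I a) = g₂ (toReduction I a)) : g₁ = g₂ := by
  have hT : (p : T) = 0 := by rw [← map_natCast g₁, reduction_natCast_p, map_zero]
  exact Ideal.Quotient.ringHom_ext (Ideal.Quotient.ringHom_ext (pCompletion_ringHom_ext hT h))

theorem exists_reduction_lift (hT : (p : T) = 0) (g : A →+* T) {S : Set A}
    (hS : ∀ a ∈ S, g a = 0) {I : Ideal (PCompletion p A)}
    (hI : I = Ideal.span (toPCompletion p A '' S)) :
    ∃ Φ : (PCompletion p A ⧸ I) ⧸ Ideal.span {(p : PCompletion p A ⧸ I)} →+* T,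
      ∀ a, Φ (toReduction I a) = g a := by
  obtain ⟨Ψ, hΨ⟩ := exists_pCompletion_lift hT g
  have hle : I ≤ RingHom.ker Ψ := by
    rw [hI]
    refine Ideal.span_le.2 ?_
    rintro _ ⟨a, ha, rfl⟩
    rw [SetLike.mem_coe, RingHom.mem_ker, hΨ, hS a ha]
  let Ψ' : PCompletion p A ⧸ I →+* T := Ideal.Quotient.lift I Ψ fun a ha => hle ha
  refine ⟨Ideal.Quotient.lift _ Ψ' fun a ha => ?_, fun a => hΨ a⟩
  obtain ⟨b, rfl⟩ := Ideal.mem_span_singleton.1 ha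
  rw [map_mul, map_natCast, hT, zero_mul]

end PCompletion

/-! ### The universal property of a direct limit of localizations -/

section LocalizationLimit

universe u

variable {B : ℕ → Type u} [∀ n, CommRing (B n)] {tr : ∀ n n', n ≤ n' → B n →+* B n'}
  {x : ∀ n, B n} {L : ℕ → Type u} [∀ n, CommRing (L n)] [∀ n, Algebra (B n) (L n)]
  [∀ n, IsLocalization.Away (x n) (L n)] {f : ∀ n n', n ≤ n' → L n →+* L n'}
  {T : Type*} [CommRing T]

/-- The map from a term of a system of rings to the direct limit of the localizations. -/
noncomputable def toLocalizationLimit (L : ℕ → Type u) [∀ n, CommRing (L n)]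
    [∀ n, Algebra (B n) (L n)] (f : ∀ n n', n ≤ n' → L n →+* L n') (n : ℕ) :
    B n →+* Ring.DirectLimit L fun n n' h => f n n' h :=
  (Ring.DirectLimit.of L (fun n n' h => f n n' h) n).comp (algebraMap (B n) (L n))

theorem toLocalizationLimit_transition
    (hf : ∀ n n' h b, f n n' h (algebraMap (B n) (L n) b) = algebraMap _ _ (tr n n' h b))
    {n n' : ℕ} (h : n ≤ n') (b : B n) :
    toLocalizationLimit L f n' (tr n n' h b) = toLocalizationLimit L f n b := by
  unfold toLocalizationLimit
  rw [RingHom.comp_apply, RingHom.comp_apply, ← hf,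
    Ring.DirectLimit.of_f (f := fun n n' h => f n n' h)]

theorem localizationLimit_ringHom_ext (x : ∀ n, B n) [∀ n, IsLocalization.Away (x n) (L n)]
    {g₁ g₂ : (Ring.DirectLimit L fun n n' h => f n n' h) →+* T}
    (h : ∀ n, g₁.comp (toLocalizationLimit (B := B) L f n) = g₂.comp (toLocalizationLimit L f n)) :
    g₁ = g₂ := by
  refine Ring.DirectLimit.hom_ext _ fun n => ?_
  exact IsLocalization.ringHom_ext (Submonoid.powers (x n)) (h n)

theorem isUnit_toLocalizationLimit (x : ∀ n, B n) [∀ n, IsLocalization.Away (x n) (L n)] (n : ℕ) :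
    IsUnit (toLocalizationLimit L f n (x n)) :=
  (IsLocalization.Away.algebraMap_isUnit (S := L n) (x n)).map
    (Ring.DirectLimit.of L (fun n n' h => f n n' h) n)

theorem exists_localizationLimit_lift (x : ∀ n, B n) [∀ n, IsLocalization.Away (x n) (L n)]
    (hf : ∀ n n' h b, f n n' h (algebraMap (B n) (L n) b) = algebraMap _ _ (tr n n' h b))
    (g : ∀ n, B n →+* T) (hg : ∀ n n' h b, g n' (tr n n' h b) = g n b)
    (hu : ∀ n, IsUnit (g n (x n))) :
    ∃ Φ : (Ring.DirectLimit L fun n n' h => f n n' h) →+* T,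
      ∀ n b, Φ (toLocalizationLimit L f n b) = g n b := by
  let G (n : ℕ) : L n →+* T := IsLocalization.Away.lift (x n) (hu n)
  have hG (n : ℕ) (b : B n) : G n (algebraMap _ _ b) = g n b :=
    IsLocalization.Away.lift_eq (x n) (hu n) b
  have hc (n n' : ℕ) (h : n ≤ n') : (G n').comp (f n n' h) = G n := by
    refine IsLocalization.ringHom_ext (Submonoid.powers (x n)) ?_
    ext b
    rw [RingHom.comp_apply, RingHom.comp_apply, RingHom.comp_apply, hf, hG, hG, hg]
  refine ⟨Ring.DirectLimit.lift L _ T G fun n n' h y => DFunLike.congr_fun (hc n n' h) y,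
    fun n b => ?_⟩
  rw [toLocalizationLimit, RingHom.comp_apply, Ring.DirectLimit.lift_of, hG]

end LocalizationLimit

/-! ### The universal property of the limit of the jet rings -/

section JetLim

variable {p : ℕ} [hp : Fact p.Prime] {ι κ : Type*} {m : ℕ}
  (P : Algebra.Presentation (ZpUr p) (WittRing p m) ι κ) {T : Type*} [CommRing T]

/-- The image in the reduction of `O^n` of an element of `R[x, …, x^(n)]`. -/
noncomputable def jetBarMk (n : ℕ) : jetPoly p ι n →+* JetRingBar P n :=
  toReduction (jetIdeal P n)

theorem jetBar_jetMk {r n : ℕ} (h : r ≤ n) (a : jetPoly p ι r) :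
    jetBar P h (jetMk P r a) = jetBarMk P n (jetPolyIncl h a) :=
  congrArg (Ideal.Quotient.mk (Ideal.span {(p : JetRing P n)})) (jetTransition_jetMk P h a)

theorem jetTransitionBar_jetBarMk {n n' : ℕ} (h : n ≤ n') (a : jetPoly p ι n) :
    jetTransitionBar P h (jetBarMk P n a) = jetBarMk P n' (jetPolyIncl h a) :=
  congrArg (Ideal.Quotient.mk (Ideal.span {(p : JetRing P n')})) (jetTransition_jetMk P h a)

theorem jetBarMk_jetDeltaIter {r n : ℕ} (h : r ≤ n) (s : κ) :
    jetBarMk P n (jetDeltaIter p (P.relation s) h) = 0 := by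
  have : Ideal.Quotient.mk (jetIdeal P n)
      (toPCompletion p _ (jetDeltaIter p (P.relation s) h)) = 0 :=
    Ideal.Quotient.eq_zero_iff_mem.2 (Ideal.subset_span ⟨r, h, s, rfl⟩)
  exact (congrArg (Ideal.Quotient.mk (Ideal.span {(p : JetRing P n)})) this).trans (map_zero _)

theorem jetPi_eq_jetMk :
    jetPi P = jetMk P 1 (1 - jetDeltaIter p (P.σ (wittV p m 1)) (le_refl 1)) := by
  rw [map_sub, map_one]
  rfl

theorem exists_jetRingBar_lift (hT : (p : T) = 0) (g : DiffPoly p ι →+* T)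
    (hg : ∀ (r : ℕ) (s : κ), g ((jetDelta p)^[r] (toDiffPoly p (P.relation s))) = 0) (n : ℕ) :
    ∃ Φ : JetRingBar P n →+* T, ∀ a : jetPoly p ι n, Φ (jetBarMk P n a) = g a := by
  refine exists_reduction_lift hT (g.comp (jetPoly p ι n).val.toRingHom)
    (S := {a | ∃ (r : ℕ) (h : r ≤ n) (s : κ), a = jetDeltaIter p (P.relation s) h}) ?_ ?_
  · rintro _ ⟨r, h, s, rfl⟩
    exact hg r s
  · unfold jetIdeal
    congr 1
    ext y
    constructor
    · rintro ⟨r, h, s, rfl⟩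
      exact ⟨_, ⟨r, h, s, rfl⟩, rfl⟩
    · rintro ⟨_, ⟨r, h, s, rfl⟩, rfl⟩
      exact ⟨r, h, s, rfl⟩

/-- The image of `π` in the reduction of `O^(n+1)`. -/
noncomputable abbrev jetPiBar (n : ℕ) : JetRingBar P (n + 1) :=
  jetBar P (Nat.succ_le_succ (Nat.zero_le n)) (jetPi P)

theorem jetLocMap_algebraMap (n n' : ℕ) (h : n ≤ n') (b : JetRingBar P (n + 1)) :
    jetLocMap P n n' h (algebraMap (JetRingBar P (n + 1)) (JetLoc P n) b) =
      algebraMap (JetRingBar P (n' + 1)) (JetLoc P n')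
        (jetTransitionBar P (Nat.add_le_add_right h 1) b) :=
  IsLocalization.map_eq _ b

/-- The map from the reduction of `O^(n+1)` to the direct limit. -/
noncomputable def jetRingBarToJetLim (n : ℕ) : JetRingBar P (n + 1) →+* JetLim P :=
  toLocalizationLimit (B := fun n => JetRingBar P (n + 1)) (JetLoc P) (jetLocMap P) n

theorem jetRingBarToJetLim_transition {n n' : ℕ} (h : n ≤ n') (b : JetRingBar P (n + 1)) :
    jetRingBarToJetLim P n' (jetTransitionBar P (Nat.add_le_add_right h 1) b) =
      jetRingBarToJetLim P n b :=
  toLocalizationLimit_transition (B := fun n => JetRingBar P (n + 1))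
    (tr := fun _ _ h => jetTransitionBar P (Nat.add_le_add_right h 1)) (jetLocMap_algebraMap P) h b

/-- The image in the direct limit of an element of `R[x, …, x^(n+1)]`. -/
noncomputable def jetLimMk (n : ℕ) : jetPoly p ι (n + 1) →+* JetLim P :=
  (jetRingBarToJetLim P n).comp (jetBarMk P (n + 1))

theorem coe_jetPolyIncl {r n : ℕ} (h : r ≤ n) (a : jetPoly p ι r) :
    (jetPolyIncl h a : DiffPoly p ι) = a :=
  Subalgebra.coe_inclusion (jetPoly_mono p h) a

theorem toJetLim_eq_comp {r n : ℕ} (h : r ≤ n + 1) :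
    toJetLim P h = (jetRingBarToJetLim P n).comp (jetBar P h) := rfl

theorem jetLimMk_apply (n : ℕ) (a : jetPoly p ι (n + 1)) :
    jetLimMk P n a = jetRingBarToJetLim P n (jetBarMk P (n + 1) a) := RingHom.comp_apply _ _ _

theorem toJetLim_jetMk {r n : ℕ} (h : r ≤ n + 1) (a : jetPoly p ι r) :
    toJetLim P h (jetMk P r a) = jetLimMk P n (jetPolyIncl h a) := by
  rw [toJetLim_eq_comp, RingHom.comp_apply, jetBar_jetMk]
  exact (RingHom.comp_apply _ _ _).symm

theorem jetLimMk_jetPolyIncl {n n' : ℕ} (h : n ≤ n') (a : jetPoly p ι (n + 1)) :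
    jetLimMk P n' (jetPolyIncl (Nat.add_le_add_right h 1) a) = jetLimMk P n a :=
  (congrArg (jetRingBarToJetLim P n') (jetTransitionBar_jetBarMk P (Nat.add_le_add_right h 1) a)).symm.trans
    (jetRingBarToJetLim_transition P h (jetBarMk P (n + 1) a))

theorem jetLim_natCast_p : (p : JetLim P) = 0 := by
  have h : (p : JetRingBar P (0 + 1)) = 0 := reduction_natCast_p p
  rw [← map_natCast (jetRingBarToJetLim P 0), h, map_zero]

theorem jetLimMk_eq {n n' : ℕ} {a : jetPoly p ι (n + 1)} {a' : jetPoly p ι (n' + 1)}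
    (h : (a : DiffPoly p ι) = a') : jetLimMk P n a = jetLimMk P n' a' := by
  have e : jetPolyIncl (Nat.add_le_add_right (le_max_left n n') 1) a =
      jetPolyIncl (Nat.add_le_add_right (le_max_right n n') 1) a' :=
    Subtype.ext (by rw [coe_jetPolyIncl, coe_jetPolyIncl, h])
  rw [← jetLimMk_jetPolyIncl P (le_max_left n n') a, e,
    jetLimMk_jetPolyIncl P (le_max_right n n')]

theorem X_mem_jetPoly (j : ι × ℕ) : (X j : DiffPoly p ι) ∈ jetPoly p ι (j.2 + 1) :=
  Algebra.subset_adjoin ⟨j, Nat.le_succ _, rfl⟩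

variable (p) in
-- Compatible maps glue because `R{x}` is the union of the `R[x, …, x^(n+1)]`. The glued map is
-- prescribed on constants and variables, each variable being taken at a level that contains it.
theorem exists_diffPoly_ringHom (μ : ∀ n, jetPoly p ι (n + 1) →+* T)
    (hμ : ∀ {n n' : ℕ} {a : jetPoly p ι (n + 1)} {a' : jetPoly p ι (n' + 1)},
      (a : DiffPoly p ι) = a' → μ n a = μ n' a') :
    ∃ γ : DiffPoly p ι →+* T, ∀ (n : ℕ) (a : jetPoly p ι (n + 1)), γ a = μ n a := by
  let γ : DiffPoly p ι →+* T := eval₂Hom ((μ 0).comp (algebraMap (ZpUr p) (jetPoly p ι 1)))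
    fun j => μ j.2 ⟨X j, X_mem_jetPoly j⟩
  refine ⟨γ, fun n ⟨F, hF⟩ => ?_⟩
  change γ F = μ n ⟨F, hF⟩
  induction hF using Algebra.adjoin_induction with
  | mem x hx =>
    obtain ⟨j, hj, rfl⟩ := hx
    exact (eval₂Hom_X' _ _ j).trans (hμ rfl)
  | algebraMap c => exact (eval₂Hom_C _ _ c).trans (hμ rfl)
  | add x y hx hy ihx ihy =>
    exact (map_add γ x y).trans ((congrArg₂ (· + ·) ihx ihy).trans
      (map_add (μ n) ⟨x, hx⟩ ⟨y, hy⟩).symm)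
  | mul x y hx hy ihx ihy =>
    exact (map_mul γ x y).trans ((congrArg₂ (· * ·) ihx ihy).trans
      (map_mul (μ n) ⟨x, hx⟩ ⟨y, hy⟩).symm)

/-- The map from `R{x}` to the direct limit. -/
noncomputable def diffPolyToJetLim : DiffPoly p ι →+* JetLim P :=
  (exists_diffPoly_ringHom p (jetLimMk P) fun h => jetLimMk_eq P h).choose

theorem diffPolyToJetLim_coe (n : ℕ) (a : jetPoly p ι (n + 1)) :
    diffPolyToJetLim P a = jetLimMk P n a :=
  (exists_diffPoly_ringHom p (jetLimMk P) fun h => jetLimMk_eq P h).choose_spec n a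

theorem toJetLim_jetMk_eq {r n : ℕ} (h : r ≤ n + 1) (a : jetPoly p ι r) :
    toJetLim P h (jetMk P r a) = diffPolyToJetLim P a := by
  rw [toJetLim_jetMk, ← diffPolyToJetLim_coe, coe_jetPolyIncl]

theorem diffPolyToJetLim_relation (r : ℕ) (s : κ) :
    diffPolyToJetLim P ((jetDelta p)^[r] (toDiffPoly p (P.relation s))) = 0 := by
  have h := diffPolyToJetLim_coe P r (jetDeltaIter p (P.relation s) r.le_succ)
  rw [jetLimMk, RingHom.comp_apply, jetBarMk_jetDeltaIter, map_zero] at h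
  exact h

theorem jetLim_ringHom_ext {g₁ g₂ : JetLim P →+* T}
    (h : g₁.comp (diffPolyToJetLim P) = g₂.comp (diffPolyToJetLim P)) : g₁ = g₂ := by
  refine localizationLimit_ringHom_ext (B := fun n => JetRingBar P (n + 1)) (jetPiBar P)
    fun n => reduction_ringHom_ext fun a => ?_
  have h1 := DFunLike.congr_fun h (a : DiffPoly p ι)
  rw [RingHom.comp_apply, RingHom.comp_apply, diffPolyToJetLim_coe] at h1
  exact h1

theorem jetPiBar_eq (n : ℕ) : jetPiBar P n = jetBarMk P (n + 1)
    (jetPolyIncl (Nat.succ_le_succ (Nat.zero_le n))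
      (1 - jetDeltaIter p (P.σ (wittV p m 1)) (le_refl 1))) := by
  rw [jetPiBar, jetPi_eq_jetMk, jetBar_jetMk]

theorem isUnit_diffPolyToJetLim :
    IsUnit (diffPolyToJetLim P (1 - jetDelta p (toDiffPoly p (P.σ (wittV p m 1))))) := by
  have h : IsUnit (jetRingBarToJetLim P 0 (jetPiBar P 0)) :=
    isUnit_toLocalizationLimit (B := fun n => JetRingBar P (n + 1)) (jetPiBar P) 0
  rw [jetPiBar_eq] at h
  have h1 := diffPolyToJetLim_coe P 0 (jetPolyIncl (Nat.succ_le_succ (Nat.zero_le 0))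
      (1 - jetDeltaIter p (P.σ (wittV p m 1)) (le_refl 1)))
  rw [jetLimMk, RingHom.comp_apply] at h1
  rw [← h1, coe_jetPolyIncl] at h
  exact h

/-- Existence half of the universal property, with `jetLim_ringHom_ext` as the uniqueness half. The
map descends through completion, relations and reduction at each level, then through localization
and limit. -/
theorem exists_jetLim_lift (hT : (p : T) = 0) (g : DiffPoly p ι →+* T)
    (hg : ∀ (r : ℕ) (s : κ), g ((jetDelta p)^[r] (toDiffPoly p (P.relation s))) = 0)
    (hu : IsUnit (g (1 - jetDelta p (toDiffPoly p (P.σ (wittV p m 1)))))) :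
    ∃ Φ : JetLim P →+* T, Φ.comp (diffPolyToJetLim P) = g := by
  choose G hG using fun n => exists_jetRingBar_lift P hT g hg (n + 1)
  have htr (n n' : ℕ) (h : n ≤ n') (b : JetRingBar P (n + 1)) :
      G n' (jetTransitionBar P (Nat.add_le_add_right h 1) b) = G n b := by
    refine DFunLike.congr_fun (f := (G n').comp (jetTransitionBar P (Nat.add_le_add_right h 1)))
      (g := G n) (reduction_ringHom_ext fun a => ?_) b
    refine Eq.trans (congrArg (G n') (jetTransitionBar_jetBarMk P (Nat.add_le_add_right h 1) a)) ?_
    rw [hG, coe_jetPolyIncl]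
    exact (hG n a).symm
  have hunit (n : ℕ) : IsUnit (G n (jetPiBar P n)) := by
    rw [jetPiBar_eq, hG, coe_jetPolyIncl]
    exact hu
  obtain ⟨Φ, hΦ⟩ : ∃ Φ : JetLim P →+* T, ∀ n b, Φ (jetRingBarToJetLim P n b) = G n b :=
    exists_localizationLimit_lift (B := fun n => JetRingBar P (n + 1)) (L := JetLoc P)
    (f := jetLocMap P) (tr := fun _ _ h => jetTransitionBar P (Nat.add_le_add_right h 1)) (jetPiBar P)
    (jetLocMap_algebraMap P) G htr hunit
  have h (n : ℕ) (a : jetPoly p ι (n + 1)) : Φ (diffPolyToJetLim P a) = g a := by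
    rw [diffPolyToJetLim_coe, jetLimMk_apply, hΦ, hG]
  refine ⟨Φ, MvPolynomial.ringHom_ext (fun c => ?_) fun j => ?_⟩
  · exact h 0 (algebraMap (ZpUr p) _ c)
  · exact h j.2 ⟨X j, X_mem_jetPoly j⟩

end JetLim

/-! ### Comparison of an arbitrary presentation with the one by the `v_i` -/

section Comparison

variable {p : ℕ} [hp : Fact p.Prime] {ι κ : Type*} {m : ℕ}
  (P : Algebra.Presentation (ZpUr p) (WittRing p m) ι κ) {T : Type*} [CommRing T]

theorem mem_span_relation {f : MvPolynomial ι (ZpUr p)} (hf : aeval P.val f = 0) :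
    f ∈ Ideal.span (Set.range P.relation) := by
  rw [P.span_range_relation_eq_ker, P.ker_eq_ker_aeval_val]
  exact hf

/-- The ideal of `R{x}` generated by the iterates of `δ` at the relations of a presentation. -/
noncomputable def relationDeltaIdeal : Ideal (DiffPoly p ι) :=
  Ideal.span {F | ∃ (r : ℕ) (s : κ), F = (jetDelta p)^[r] (toDiffPoly p (P.relation s))}

theorem jetDelta_mem_relationDeltaIdeal (F : DiffPoly p ι) (hF : F ∈ relationDeltaIdeal P) :
    jetDelta p F ∈ relationDeltaIdeal P := by
  refine jetDelta_mem_of_span le_rfl ?_ hF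
  rintro _ ⟨r, s, rfl⟩
  exact Ideal.subset_span ⟨r + 1, s, (Function.iterate_succ_apply' _ _ _).symm⟩

theorem toDiffPoly_mem_relationDeltaIdeal {f : MvPolynomial ι (ZpUr p)}
    (hf : aeval P.val f = 0) : toDiffPoly p f ∈ relationDeltaIdeal P := by
  have h : Ideal.span (Set.range P.relation) ≤ (relationDeltaIdeal P).comap (toDiffPoly p) := by
    refine Ideal.span_le.2 ?_
    rintro _ ⟨s, rfl⟩
    exact Ideal.subset_span ⟨0, s, rfl⟩
  exact h (mem_span_relation P hf)

variable {P} {γ : DiffPoly p ι →+* T}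

theorem relationDeltaIdeal_le_ker
    (hγ : ∀ (r : ℕ) (s : κ), γ ((jetDelta p)^[r] (toDiffPoly p (P.relation s))) = 0) :
    relationDeltaIdeal P ≤ RingHom.ker γ := by
  refine Ideal.span_le.2 ?_
  rintro _ ⟨r, s, rfl⟩
  exact hγ r s

/-- Independence of representatives: the ideal of all `δ^r f` is `δ`-stable, so congruent elements
have congruent iterates. -/
theorem map_jetDelta_iterate_toDiffPoly_eq
    (hγ : ∀ (r : ℕ) (s : κ), γ ((jetDelta p)^[r] (toDiffPoly p (P.relation s))) = 0)
    {f g : MvPolynomial ι (ZpUr p)} (h : aeval P.val f = aeval P.val g) (s : ℕ) :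
    γ ((jetDelta p)^[s] (toDiffPoly p f)) = γ ((jetDelta p)^[s] (toDiffPoly p g)) := by
  rw [← sub_eq_zero, ← map_sub]
  refine relationDeltaIdeal_le_ker hγ
    (jetDelta_iterate_sub_mem (jetDelta_mem_relationDeltaIdeal P) ?_ s)
  rw [← map_sub]
  exact toDiffPoly_mem_relationDeltaIdeal P (by rw [map_sub, h, sub_self])

theorem map_jetDelta_iterate_wittV_pow (hT : (p : T) = 0)
    (hγ : ∀ (r : ℕ) (s : κ), γ ((jetDelta p)^[r] (toDiffPoly p (P.relation s))) = 0)
    (hu : IsUnit (γ (1 - jetDelta p (toDiffPoly p (P.σ (wittV p m 1)))))) {j : ℕ} (hj : 1 ≤ j)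
    (s : ℕ) : γ ((jetDelta p)^[s] (toDiffPoly p (P.σ (wittV p m j)))) ^ p = 0 := by
  have hmem {i j : ℕ} (h : i ≤ j) : toDiffPoly p (P.σ (wittV p m i)) *
      toDiffPoly p (P.σ (wittV p m j)) - (p : DiffPoly p ι) ^ i * toDiffPoly p (P.σ (wittV p m j)) ∈
      relationDeltaIdeal P := by
    have := toDiffPoly_mem_relationDeltaIdeal P (f := P.σ (wittV p m i) * P.σ (wittV p m j) -
      (p : MvPolynomial ι (ZpUr p)) ^ i * P.σ (wittV p m j)) (by
        rw [map_sub, map_mul, map_mul, map_pow, map_natCast, P.aeval_val_σ, P.aeval_val_σ,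
          wittV_mul_wittV p m h, sub_self])
    rwa [map_sub, map_mul, map_mul, map_pow, map_natCast] at this
  have h1j := hmem hj
  have h11 := hmem (le_refl 1)
  rw [pow_one] at h1j h11
  -- Take `V = v_1` and `W = v_j`; from `v_j^2 = p^j v_j` follows `v_j^p = p v_j · p^(j-1)
  -- v_j^(p-2)`, whence `g`.
  refine map_jetDelta_iterate_pow_eq_zero hT γ (jetDelta_mem_relationDeltaIdeal P)
    (relationDeltaIdeal_le_ker hγ) h11 h1j
    (g := (p : DiffPoly p ι) ^ (j - 1) * toDiffPoly p (P.σ (wittV p m j)) ^ (p - 2)) ?_ ?_ s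
  · have hjj := Ideal.mul_mem_left _ (toDiffPoly p (P.σ (wittV p m j)) ^ (p - 2)) (hmem (le_refl j))
    rw [← pow_sub_one_mul (Nat.one_le_iff_ne_zero.1 hj)] at hjj
    convert hjj using 1
    have e : toDiffPoly p (P.σ (wittV p m j)) ^ p = toDiffPoly p (P.σ (wittV p m j)) ^ (p - 2) *
        (toDiffPoly p (P.σ (wittV p m j)) * toDiffPoly p (P.σ (wittV p m j))) := by
      rw [← sq, ← pow_add, Nat.sub_add_cancel hp.out.two_le]
    rw [e]
    ring
  · rw [← neg_sub, map_neg]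
    exact hu.neg

theorem map_wittV_mul_wittV (hT : (p : T) = 0)
    (hγ : ∀ (r : ℕ) (s : κ), γ ((jetDelta p)^[r] (toDiffPoly p (P.relation s))) = 0)
    {i j : ℕ} (hi : 1 ≤ i) (hij : i ≤ j) : γ (toDiffPoly p (P.σ (wittV p m i))) *
      γ (toDiffPoly p (P.σ (wittV p m j))) = 0 := by
  have h := map_jetDelta_iterate_toDiffPoly_eq hγ (f := P.σ (wittV p m i) * P.σ (wittV p m j))
    (g := (p : MvPolynomial ι (ZpUr p)) ^ i * P.σ (wittV p m j)) (by
        rw [map_mul, map_mul, map_pow, map_natCast, P.aeval_val_σ, P.aeval_val_σ,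
          wittV_mul_wittV p m hij]) 0
  simp only [Function.iterate_zero, id_eq, map_mul, map_pow, map_natCast, hT] at h
  rw [h, zero_pow (by omega), zero_mul]

variable (P) in
/-- The map from the polynomial algebra in `v_1, …, v_m` given by the representatives of the
`v_i`. -/
noncomputable def wittPolySection : WittPoly p m →ₐ[ZpUr p] MvPolynomial ι (ZpUr p) :=
  aeval fun i => P.σ (wittV p m i)

theorem aeval_wittPolySection (f : WittPoly p m) :
    aeval P.val (wittPolySection P f) = wittEval p m f := by
  refine DFunLike.congr_fun (f := (aeval P.val).comp (wittPolySection P)) (g := wittEval p m) ?_ f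
  ext i
  rw [AlgHom.comp_apply, wittPolySection, wittEval, aeval_X, aeval_X, P.aeval_val_σ]

theorem jetProlong_C {ι' : Type*} (a : MvPolynomial ι (ZpUr p) →ₐ[ZpUr p] MvPolynomial ι' (ZpUr p))
    (c : ZpUr p) : jetProlong p a (C c) = C c :=
  (jetProlong p a).commutes c

theorem X_eq_jetDelta_iterate (j : ι × ℕ) :
    (X j : DiffPoly p ι) = (jetDelta p)^[j.2] (toDiffPoly p (X j.1)) := by
  have h : toDiffPoly p (X j.1) = (X (j.1, 0) : DiffPoly p ι) := rename_X _ _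
  rw [h, jetDelta_iterate_X, zero_add]

theorem jetProlong_X {ι' : Type*} (a : MvPolynomial ι (ZpUr p) →ₐ[ZpUr p] MvPolynomial ι' (ZpUr p))
    (j : ι × ℕ) :
    jetProlong p a (X j) = (jetDelta p)^[j.2] (toDiffPoly p (a (X j.1))) :=
  aeval_X _ _

theorem exists_limitRing_lift (hT : (p : T) = 0)
    (hγ : ∀ (r : ℕ) (s : κ), γ ((jetDelta p)^[r] (toDiffPoly p (P.relation s))) = 0)
    (hu : IsUnit (γ (1 - jetDelta p (toDiffPoly p (P.σ (wittV p m 1)))))) :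
    ∃ Λ : LimitRing p m →+* T, Λ.comp (toLimitRing p m) =
      γ.comp (jetProlong p (wittPolySection P)).toRingHom := by
  let c : ResField p →+* T := Ideal.Quotient.lift _ (γ.comp C) fun a ha => by
    obtain ⟨b, rfl⟩ := Ideal.mem_span_singleton.1 ha
    rw [map_mul, map_natCast, hT, zero_mul]
  let Λ₀ : MvPolynomial (Set.Icc 1 m × ℕ) (ResField p) →+* T := eval₂Hom c
    fun j => γ ((jetDelta p)^[j.2] (toDiffPoly p (P.σ (wittV p m j.1))))
  have hX (j) : Λ₀ (X j) = γ ((jetDelta p)^[j.2] (toDiffPoly p (P.σ (wittV p m j.1)))) :=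
    eval₂Hom_X' _ _ j
  have hle : limitIdeal p m ≤ RingHom.ker Λ₀ := by
    refine Ideal.span_le.2 ?_
    rintro _ (⟨i, j, rfl⟩ | ⟨i, r, -, rfl⟩)
    · rw [SetLike.mem_coe, RingHom.mem_ker, map_mul, hX, hX]
      rcases le_total (i : ℕ) j with h | h
      · exact map_wittV_mul_wittV hT hγ i.2.1 h
      · rw [mul_comm]
        exact map_wittV_mul_wittV hT hγ j.2.1 h
    · rw [SetLike.mem_coe, RingHom.mem_ker, map_pow, hX]
      exact map_jetDelta_iterate_wittV_pow hT hγ hu i.2.1 r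
  refine ⟨Ideal.Quotient.lift _ Λ₀ fun a ha => RingHom.mem_ker.1 (hle ha),
    MvPolynomial.ringHom_ext (fun a => ?_) fun j => ?_⟩
  · have h : Λ₀ (C (Ideal.Quotient.mk _ a)) = γ (C a) := eval₂Hom_C _ _ _
    rw [RingHom.comp_apply, toLimitRing_C, Ideal.Quotient.lift_mk, h]
    exact congrArg γ (jetProlong_C _ a).symm
  · rw [RingHom.comp_apply, toLimitRing_X, Ideal.Quotient.lift_mk, hX]
    refine congrArg γ (Eq.trans ?_ (jetProlong_X _ j).symm)
    rw [wittPolySection, aeval_X]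

variable (P) in
theorem exists_algHom_wittPoly : ∃ a : MvPolynomial ι (ZpUr p) →ₐ[ZpUr p] WittPoly p m,
    ∀ f, wittEval p m (a f) = aeval P.val f := by
  choose c hc using fun i => wittEval_surjective p m (P.val i)
  refine ⟨aeval c, fun f => DFunLike.congr_fun (f := (wittEval p m).comp (aeval c))
    (g := aeval P.val) ?_ f⟩
  ext i
  rw [AlgHom.comp_apply, aeval_X, aeval_X, hc]

theorem isUnit_one_sub_X (i : Set.Icc 1 m) (r : ℕ) :
    IsUnit (1 - toLimitRing p m (X (i, r))) :=
  IsNilpotent.isUnit_one_sub ⟨p, by rw [← map_pow, toLimitRing_X_pow]⟩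

/-- Uses only the universal property of `T`. One map comes from writing the generators of the
presentation as polynomials in the `v_i`, the other from the chosen representatives of the `v_i`.
The composites need not be the identity on polynomials, but they preserve classes in `W_m(R)`, which
determine the images of all `δ^r`. -/
theorem exists_equiv_limitRing (hm : 1 ≤ m) (hT : (p : T) = 0)
    (hγ : ∀ (r : ℕ) (s : κ), γ ((jetDelta p)^[r] (toDiffPoly p (P.relation s))) = 0)
    (hu : IsUnit (γ (1 - jetDelta p (toDiffPoly p (P.σ (wittV p m 1))))))
    (hext : ∀ g₁ g₂ : T →+* T, g₁.comp γ = g₂.comp γ → g₁ = g₂)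
    (hlift : ∀ g : DiffPoly p ι →+* LimitRing p m,
      (∀ (r : ℕ) (s : κ), g ((jetDelta p)^[r] (toDiffPoly p (P.relation s))) = 0) →
      IsUnit (g (1 - jetDelta p (toDiffPoly p (P.σ (wittV p m 1))))) →
      ∃ Φ : T →+* LimitRing p m, Φ.comp γ = g) :
    ∃ Θ : T ≃+* LimitRing p m, (∀ c : ZpUr p, Θ (γ (C c)) = toLimitRing p m (C c)) ∧
      ∀ (i : Set.Icc 1 m) (r : ℕ),
        Θ (γ ((jetDelta p)^[r] (toDiffPoly p (P.σ (wittV p m i))))) =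
          toLimitRing p m (X (i, r)) := by
  obtain ⟨a, ha⟩ := exists_algHom_wittPoly P
  have hδ (f : MvPolynomial ι (ZpUr p)) (g : WittPoly p m) (h : aeval P.val f = wittEval p m g)
      (r : ℕ) : toLimitRing p m (jetProlong p a ((jetDelta p)^[r] (toDiffPoly p f))) =
        toLimitRing p m ((jetDelta p)^[r] (toDiffPoly p g)) := by
    rw [jetProlong_jetDelta_iterate, jetProlong_toDiffPoly]
    exact toLimitRing_jetDelta_iterate_eq p m ((ha f).trans h) r
  have hδX (i : Set.Icc 1 m) (r : ℕ) : toLimitRing p m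
      (jetProlong p a ((jetDelta p)^[r] (toDiffPoly p (P.σ (wittV p m i))))) =
        toLimitRing p m (X (i, r)) := by
    rw [hδ _ (X i) (by rw [P.aeval_val_σ, wittEval, aeval_X]), X_eq_jetDelta_iterate (i, r)]
  set g : DiffPoly p ι →+* LimitRing p m :=
    (toLimitRing p m).comp (jetProlong p a).toRingHom with hg
  have hgr (r : ℕ) (s : κ) : g ((jetDelta p)^[r] (toDiffPoly p (P.relation s))) = 0 := by
    have h0 : (jetDelta p)^[r] (toDiffPoly p (0 : WittPoly p m)) = 0 := by
      rw [map_zero]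
      exact Function.iterate_fixed (jetDelta_zero p) r
    have := hδ (P.relation s) 0 (by rw [P.aeval_val_relation, map_zero]) r
    rwa [h0, map_zero] at this
  have hgu : IsUnit (g (1 - jetDelta p (toDiffPoly p (P.σ (wittV p m 1))))) := by
    rw [map_sub, map_one]
    have := hδX ⟨1, le_rfl, hm⟩ 1
    rw [Function.iterate_one] at this
    have h := isUnit_one_sub_X (p := p) (⟨1, le_rfl, hm⟩ : Set.Icc 1 m) 1
    rw [← this] at h
    exact h
  obtain ⟨Φ, hΦ⟩ := hlift g hgr hgu
  obtain ⟨Λ, hΛ⟩ := exists_limitRing_lift hT hγ hu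
  have hΦ' (F : DiffPoly p ι) : Φ (γ F) = toLimitRing p m (jetProlong p a F) :=
    DFunLike.congr_fun hΦ F
  have hΛ' (F : DiffPoly p (Set.Icc 1 m)) : Λ (toLimitRing p m F) =
      γ (jetProlong p (wittPolySection P) F) := DFunLike.congr_fun hΛ F
  have h1 : Λ.comp Φ = RingHom.id _ := by
    refine hext _ _ (MvPolynomial.ringHom_ext (fun c => ?_) fun j => ?_)
    · rw [RingHom.comp_apply, RingHom.comp_apply, hΦ', hΛ', jetProlong_C, jetProlong_C]
      rfl
    · rw [RingHom.comp_apply, RingHom.comp_apply, hΦ', hΛ', jetProlong_X,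
        jetProlong_jetDelta_iterate, jetProlong_toDiffPoly]
      refine (map_jetDelta_iterate_toDiffPoly_eq hγ (g := X j.1) ?_ j.2).trans ?_
      · rw [aeval_wittPolySection, ha]
      · rw [← X_eq_jetDelta_iterate]
        rfl
  have h2 : Φ.comp Λ = RingHom.id _ := by
    refine (RingHom.cancel_right (toLimitRing_surjective p m)).1
      (MvPolynomial.ringHom_ext (fun c => ?_) fun j => ?_)
    · rw [RingHom.comp_apply, RingHom.comp_apply, hΛ', hΦ', jetProlong_C, jetProlong_C]
      rfl
    · rw [RingHom.comp_apply, RingHom.comp_apply, hΛ', hΦ', jetProlong_X, wittPolySection, aeval_X,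
        hδX]
      rfl
  refine ⟨RingEquiv.ofRingHom Φ Λ h2 h1, fun c => ?_, fun i r => ?_⟩
  · exact (hΦ' (C c)).trans (congrArg _ (jetProlong_C a c))
  · exact (hΦ' _).trans (hδX i r)

theorem coe_jetDeltaIter (f : MvPolynomial ι (ZpUr p)) {r n : ℕ} (h : r ≤ n) :
    (jetDeltaIter p f h : DiffPoly p ι) = (jetDelta p)^[r] (toDiffPoly p f) := rfl

variable (P) in
theorem toJetLim_jetConst {r n : ℕ} (h : r ≤ n + 1) (c : ZpUr p) :
    toJetLim P h (jetConst P r c) = diffPolyToJetLim P (C c) :=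
  toJetLim_jetMk_eq P h (algebraMap (ZpUr p) (jetPoly p ι r) c)

variable (P) in
theorem toJetLim_jetDeltaClass {r n : ℕ} (h : r ≤ n + 1) (a : WittRing p m) :
    toJetLim P h (jetDeltaClass P r a) =
      diffPolyToJetLim P ((jetDelta p)^[r] (toDiffPoly p (P.σ a))) :=
  toJetLim_jetMk_eq P h (jetDeltaIter p (P.σ a) (le_refl r))

variable (P) in
theorem isIdempotentElem_jetBar_jetPi_pow {n : ℕ} (hn : 2 ≤ n) :
    IsIdempotentElem (jetBar P (le_trans one_le_two hn) (jetPi P ^ p)) := by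
  -- Idempotence is proved with elements of order `2` and carried to order `n` by the inclusion of
  -- polynomial rings.
  have h := isIdempotentElem_map_one_sub_pow P.relation (reduction_natCast_p (C := JetRing P n) p)
    ((jetBarMk P n).comp (jetPolyIncl hn)) (fun r hr s => jetBarMk_jetDeltaIter P (hr.trans hn) s)
    (v := P.σ (wittV p m 1)) (mem_span_relation P (by
      rw [map_sub, map_mul, map_mul, map_natCast, P.aeval_val_σ, wittV_mul_wittV p m le_rfl,
        pow_one, sub_self]))
  have e : jetPolyIncl (p := p) (le_trans one_le_two hn)
      ((1 - jetDeltaIter p (P.σ (wittV p m 1)) (le_refl 1)) ^ p) =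
      jetPolyIncl hn ((1 - jetDeltaIter p (P.σ (wittV p m 1)) one_le_two) ^ p) :=
    Subtype.ext (by
      rw [coe_jetPolyIncl, coe_jetPolyIncl]
      push_cast
      rw [coe_jetDeltaIter, coe_jetDeltaIter])
  rw [RingHom.comp_apply] at h
  rw [jetPi_eq_jetMk, ← map_pow (jetMk P 1), jetBar_jetMk, e]
  exact h

end Comparison

theorem mainTheorem12 (p : ℕ) [Fact p.Prime] (m : ℕ) (hm : 1 ≤ m)
    {ι κ : Type*} [Finite ι] [Finite κ]
    (P : Algebra.Presentation (ZpUr p) (WittRing p m) ι κ) :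
    (∀ (n : ℕ) (hn : 2 ≤ n),
      IsIdempotentElem (jetBar P (le_trans one_le_two hn) (jetPi P ^ p))) ∧
    ∃ Θ : JetLim P ≃+* LimitRing p m,
      (∀ (r n : ℕ) (h : r ≤ n + 1) (c : ZpUr p),
        Θ (toJetLim P h (jetConst P r c)) =
          Ideal.Quotient.mk (limitIdeal p m)
            (MvPolynomial.C (Ideal.Quotient.mk (Ideal.span {(p : ZpUr p)}) c))) ∧
      ∀ (i : Set.Icc 1 m) (r n : ℕ) (h : r ≤ n + 1),
        Θ (toJetLim P h (jetDeltaClass P r (wittV p m i))) =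
          Ideal.Quotient.mk (limitIdeal p m) (MvPolynomial.X (i, r)) := by
  refine ⟨fun n hn => isIdempotentElem_jetBar_jetPi_pow P hn, ?_⟩
  obtain ⟨Θ, hC, hX⟩ := exists_equiv_limitRing hm (jetLim_natCast_p P)
    (diffPolyToJetLim_relation P) (isUnit_diffPolyToJetLim P)
    (fun _ _ => jetLim_ringHom_ext P) (exists_jetLim_lift (T := LimitRing p m) P (limitRing_natCast_p p m))
  exact ⟨Θ, fun r n h c => (congrArg Θ (toJetLim_jetConst P h c)).trans
      ((hC c).trans (toLimitRing_C p m c)),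
    fun i r n h => (congrArg Θ (toJetLim_jetDeltaClass P h (wittV p m i))).trans
      ((hX i r).trans (toLimitRing_X p m (i, r)))⟩
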